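/- Let $\Gamma$ be a finite simplicial graph with $|V(\Gamma)|\ge 2$ whose complement graph $\bar\Gamma$ is connected, and let $A(\Gamma)$ be the right-angled Artin group generated by $V(\Gamma)$ with the relations that adjacent vertices commute. A star-word is an element of $A(\Gamma)$ that commutes with some vertex of $\Gamma$; the star length $\|g\|_*$ is the least $\ell$ such that $g$ is a product of $\ell$ star-words; and $d_*(g,h)=\|gh^{-1}\|_*$. The group $A(\Gamma)$ acts isometrically on the metric space $(A(\Gamma),d_*)$ by right multiplication. For $x,y\in A(\Gamma)$ and a real number $r>0$ put $$\xi(x,y;r)=\{g\in A(\Gamma): d_*(xg,x)\le r\ \text{and}\ d_*(yg,y)\le r\}.$$ Let $V=\max\{4,|V(\Gamma)|\}$, $R(r)=(2V+7)r+8$ and $N(r)=\max\{1,\,2(V-2)(r-1)-1\}$ (so $N(r)=2(V-2)(r-1)-1$ whenever $r\ge 2$). Then the action of $A(\Gamma)$ on $(A(\Gamma),d_*)$ is $(R,N)$-acylindrical: for every real $r>0$ and all $x,y\in A(\Gamma)$ with $d_*(x,y)\ge R(r)$, the set $\xi(x,y;r)$ has at most $N(r)$ elements. Moreover, for every real $r>0$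 and all $x,y\in A(\Gamma)$ with $d_*(x,y)\ge R(r)$, if $\xi(x,y;r)\ne\{1\}$, then there exists an element $g\in A(\Gamma)$ which is loxodromic on $(A(\Gamma),d_*)$ (that is, $\lim_{n\to\infty} d_*(xg^n,x)/n$ exists, is positive, and does not depend on the base point $x$) such that (i) $\xi(x,y;r)=\{1,g^{\pm1},g^{\pm2},\dots,g^{\pm k}\}$ for some integer $k$ with $1\le k\le (V-2)(r-1)-1$; (ii) the Hausdorff distance, with respect to $d_*$, between the orbits $x\langle g\rangle=\{xg^m:m\in\mathbb Z\}$ and $y\langle g\rangle$ is at most $2r+3$. -/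

import Mathlib

open scoped RightActions

/-! ### Isometric right actions on metric spaces

A right action of `G` on `X` is an action of `Gᵐᵒᵖ`; `x <• g` is the image of `x` under `g`. -/

/-- The `r`-quasi-stabilizer `ξ(x, y; r)` of a pair of points, for a right action of `G` on `X`. -/
def quasiStabilizer (G : Type*) {X : Type*} [Group G] [PseudoMetricSpace X] [MulAction Gᵐᵒᵖ X]
    (x y : X) (r : ℝ) : Set G :=
  {g | dist (x <• g) x ≤ r ∧ dist (y <• g) y ≤ r}

/-- The isometric right action of `G` on `X` is `(R, N)`-acylindrical: for every `r > 0` the numbers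
`R r` and `N r` are positive, and the `r`-quasi-stabilizer of any two points at distance at least
`R r` has at most `N r` elements. -/
def IsAcylindricalWith (G X : Type*) [Group G] [PseudoMetricSpace X] [MulAction Gᵐᵒᵖ X]
    [IsIsometricSMul Gᵐᵒᵖ X] (R N : ℝ → ℝ) : Prop :=
  ∀ r : ℝ, 0 < r → 0 < R r ∧ 0 < N r ∧
    ∀ x y : X, R r ≤ dist x y →
      (quasiStabilizer G x y r).Finite ∧ ((quasiStabilizer G x y r).ncard : ℝ) ≤ N r

/-- `g` acts on `X` with asymptotic translation length `τ`: for every base point `x`, the sequence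
`d(x gⁿ, x) / n` converges to `τ`. -/
def HasTranslationLength {G : Type*} (X : Type*) [Group G] [PseudoMetricSpace X]
    [MulAction Gᵐᵒᵖ X] (g : G) (τ : ℝ) : Prop :=
  ∀ x : X, Filter.Tendsto (fun n : ℕ => dist (x <• (g ^ n)) x / (n : ℝ)) Filter.atTop (nhds τ)

/-- `g` is loxodromic on `X`: its asymptotic translation length is positive. -/
def IsLoxodromic {G : Type*} (X : Type*) [Group G] [PseudoMetricSpace X] [MulAction Gᵐᵒᵖ X]
    (g : G) : Prop :=
  ∃ τ : ℝ, 0 < τ ∧ HasTranslationLength X g τ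

/-- The orbit `x⟨g⟩` of `x` under the cyclic group generated by `g`. -/
def cyclicOrbit {G X : Type*} [Group G] [MulAction Gᵐᵒᵖ X] (g : G) (x : X) : Set X :=
  Set.range fun m : ℤ => x <• (g ^ m)

/-! ### Right-angled Artin groups and the star metric -/

/-- The right-angled Artin group `A(Γ)`: generated by the vertices of `Γ`, subject to the relations
that adjacent vertices commute. -/
def RAAG {V : Type*} (Γ : SimpleGraph V) : Type _ :=
  PresentedGroup
    {c : FreeGroup V | ∃ v w : V, Γ.Adj v w ∧
      c = FreeGroup.of v * FreeGroup.of w * (FreeGroup.of v)⁻¹ * (FreeGroup.of w)⁻¹}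

namespace RAAG

variable {V : Type*} {Γ : SimpleGraph V}

instance instGroup : Group (RAAG Γ) :=
  inferInstanceAs (Group (PresentedGroup _))

/-- The generator of `A(Γ)` given by a vertex. -/
def of (v : V) : RAAG Γ :=
  PresentedGroup.of v

/-- A star-word: an element of the centralizer of some vertex. -/
def IsStarWord (g : RAAG Γ) : Prop :=
  ∃ v : V, g ∈ Subgroup.centralizer {(of v : RAAG Γ)}

/-- `g` is a product of `n` star-words. -/
def IsProdStarWords (g : RAAG Γ) (n : ℕ) : Prop :=
  ∃ l : List (RAAG Γ), l.length = n ∧ (∀ s ∈ l, IsStarWord s) ∧ l.prod = g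

/-- The star length `‖g‖_*`: the least `n` such that `g` is a product of `n` star-words. -/
noncomputable def starLength (g : RAAG Γ) : ℕ :=
  sInf {n | IsProdStarWords g n}

theorem isStarWord_of (v : V) : IsStarWord (of v : RAAG Γ) :=
  ⟨v, Subgroup.mem_centralizer_singleton_iff.2 rfl⟩

theorem IsStarWord.inv {g : RAAG Γ} (h : IsStarWord g) : IsStarWord g⁻¹ :=
  h.imp fun _ hv => inv_mem hv

theorem exists_isProdStarWords (g : RAAG Γ) : ∃ n, IsProdStarWords g n := by
  have hg : g ∈ Subgroup.closure (Set.range (of : V → RAAG Γ)) := by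
    exact (Subgroup.eq_top_iff' _).1 (PresentedGroup.closure_range_of _) g
  rw [← Subgroup.mem_toSubmonoid, Subgroup.closure_toSubmonoid] at hg
  obtain ⟨l, hl, rfl⟩ := Submonoid.exists_list_of_mem_closure hg
  refine ⟨l.length, l, rfl, fun s hs => ?_, rfl⟩
  rcases hl s hs with ⟨v, rfl⟩ | ⟨v, hv⟩
  · exact isStarWord_of v
  · rw [← inv_inv s, ← hv]
    exact (isStarWord_of v).inv

/-- The minimum in the definition of the star length is attained. -/
theorem isProdStarWords_starLength (g : RAAG Γ) : IsProdStarWords g (starLength g) :=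
  Nat.sInf_mem (exists_isProdStarWords g)

theorem starLength_le {g : RAAG Γ} {n : ℕ} (h : IsProdStarWords g n) : starLength g ≤ n :=
  Nat.sInf_le h

theorem starLength_one : starLength (1 : RAAG Γ) = 0 :=
  Nat.le_zero.1 (starLength_le ⟨[], rfl, by simp, rfl⟩)

theorem eq_one_of_starLength_eq_zero {g : RAAG Γ} (h : starLength g = 0) : g = 1 := by
  obtain ⟨l, hl, -, rfl⟩ := isProdStarWords_starLength g
  rw [h, List.length_eq_zero_iff] at hl
  simp [hl]

theorem starLength_mul_le (g h : RAAG Γ) : starLength (g * h) ≤ starLength g + starLength h := by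
  obtain ⟨l, hl, hs, hg⟩ := isProdStarWords_starLength g
  obtain ⟨m, hm, ht, hh⟩ := isProdStarWords_starLength h
  refine starLength_le ⟨l ++ m, by simp [hl, hm], fun s h' => ?_, by simp [hg, hh]⟩
  exact (List.mem_append.1 h').elim (hs s) (ht s)

theorem starLength_inv_le (g : RAAG Γ) : starLength g⁻¹ ≤ starLength g := by
  obtain ⟨l, hl, hs, hg⟩ := isProdStarWords_starLength g
  refine starLength_le ⟨(l.map fun s => s⁻¹).reverse, by simp [hl], fun s h' => ?_, ?_⟩
  · simp only [List.mem_reverse, List.mem_map] at h'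
    obtain ⟨t, ht, rfl⟩ := h'
    exact (hs t ht).inv
  · rw [← List.prod_inv_reverse, hg]

theorem starLength_inv (g : RAAG Γ) : starLength g⁻¹ = starLength g :=
  le_antisymm (starLength_inv_le g) (by simpa using starLength_inv_le g⁻¹)

/-- The star metric `d_*(g, h) = ‖g h⁻¹‖_*` on `A(Γ)`. -/
noncomputable instance instMetricSpace : MetricSpace (RAAG Γ) where
  dist g h := (starLength (g * h⁻¹) : ℝ)
  dist_self g := by simp [starLength_one]
  dist_comm g h := by
    rw [← starLength_inv (g * h⁻¹)]
    simp
  dist_triangle g h k := by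
    have := starLength_mul_le (g * h⁻¹) (h * k⁻¹)
    rw [show g * h⁻¹ * (h * k⁻¹) = g * k⁻¹ by group] at this
    exact_mod_cast this
  eq_of_dist_eq_zero {g h} hgh :=
    mul_inv_eq_one.1 (eq_one_of_starLength_eq_zero (Nat.cast_eq_zero.1 hgh))

theorem dist_def (g h : RAAG Γ) : dist g h = (starLength (g * h⁻¹) : ℝ) :=
  rfl

theorem smul_def (g x : RAAG Γ) : x <• g = x * g :=
  rfl

/-- `A(Γ)` acts on `(A(Γ), d_*)` isometrically by right multiplication. -/
instance instIsIsometricSMul : IsIsometricSMul (RAAG Γ)ᵐᵒᵖ (RAAG Γ) where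
  isometry_smul c := Isometry.of_dist_eq fun x y => by
    rw [dist_def, dist_def, ← MulOpposite.op_unop c, smul_def, smul_def]
    congr 2
    group

end RAAG

/-! Put `w = x * y⁻¹`. Conjugation by `x` turns a member of ξ(x,y;r) into some `h'` such that `h'`
and `h = w⁻¹ * h' * w` both have star length at most ρ = ⌊r⌋, while `w` is long.

The tools are combinatorial. Reduced traces give a normal form, hence letter counts `cnt`, reduced
products `Red` and the prefix order `Le`. Prefixes of a fixed element are determined by their counts
(`Le.eq_of_cnt_eq`), and its letters at non-adjacent vertices are linearly ordered
(`Le.cnt_le_cnt`). Prefixes of one element differ from their meet by commuting remainders, and a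
remainder that commutes in this way with something of star length at least 2 is trivial
(`AdjSupp.eq_one`).

In `h' * w = w * h` cancellation takes place only near the ends, so a long middle part `m` of `w`
slides rigidly: `w = p * m * s = p' * m * s'` (`exists_shiftDecomp`). This has two consequences.
First, `h'⁻¹` moves the prefixes of `w` that end far from both ends by a constant vector of counts,
so all such `h'` commute (`commute_of_le_starLength`). Secondly, if `h' ≠ 1`, then `m` overlaps its
own translate and is nearly a power of some `e`. Hence `h'` is a conjugate of a cyclically reduced
element with rich support, and some power of `h'` shortens `w` to star length at most 2ρ + 1
(`exists_root`), which bounds the Hausdorff distance.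

The centralizer of such an element is cyclic (`isCyclic_centralizer`), so the quasi-stabilizer lies
in a cyclic group. Star length is monotone along powers (`starLength_pow_mono`), which makes it a
symmetric interval of exponents. The growth estimate `lt_starLength_pow` bounds this interval and
shows that the generator is loxodromic. -/

namespace RAAG

/-! ### Traces and reduced traces. -/

section Words

open scoped Classical

variable {V : Type*} (Γ : SimpleGraph V)

/-- The inverse of a letter `v^{±1}`, encoded as a pair of a vertex and a sign. -/
def bar (a : V × Bool) : V × Bool := (a.1, !a.2)

@[simp] theorem bar_fst (a : V × Bool) : (bar a).1 = a.1 := rfl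

@[simp] theorem bar_bar (a : V × Bool) : bar (bar a) = a := by
  simp [bar]

theorem bar_ne (a : V × Bool) : bar a ≠ a := fun h => by
  have := congrArg Prod.snd h
  simp [bar] at this

/-- The subword of the letters whose vertex is `u` or `v`. -/
noncomputable def proj (u v : V) (ω : List (V × Bool)) : List (V × Bool) :=
  ω.filter fun a => a.1 = u ∨ a.1 = v

/-- Two words are trace equivalent if they have the same projections to every pair of
non-adjacent vertices. -/
def traceSetoid : Setoid (List (V × Bool)) where
  r ω ω' := ∀ u v, ¬Γ.Adj u v → proj u v ω = proj u v ω'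
  iseqv :=
    ⟨fun _ _ _ _ => rfl, fun h u v huv => (h u v huv).symm,
      fun h h' u v huv => (h u v huv).trans (h' u v huv)⟩

/-- Traces: words up to exchanging neighbouring letters with adjacent vertices. -/
def Trace : Type _ := Quotient (traceSetoid Γ)

variable {Γ}

/-- The trace of a word. -/
def Trace.mk (ω : List (V × Bool)) : Trace Γ := Quotient.mk (traceSetoid Γ) ω

theorem Trace.mk_eq {ω ω' : List (V × Bool)} :
    (Trace.mk ω : Trace Γ) = Trace.mk ω' ↔ ∀ u v, ¬Γ.Adj u v → proj u v ω = proj u v ω' :=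
  Quotient.eq (r := traceSetoid Γ)

theorem proj_cons (u v : V) (a : V × Bool) (ω : List (V × Bool)) :
    proj u v (a :: ω) = if a.1 = u ∨ a.1 = v then a :: proj u v ω else proj u v ω := by
  simp only [proj, List.filter_cons, decide_eq_true_eq]

theorem proj_append (u v : V) (ω ω' : List (V × Bool)) :
    proj u v (ω ++ ω') = proj u v ω ++ proj u v ω' := by
  simp [proj]

/-- Prepending a letter to a trace. -/
def Trace.cons (a : V × Bool) (x : Trace Γ) : Trace Γ :=
  Quotient.liftOn x (fun ω => Trace.mk (a :: ω)) fun ω ω' h => by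
    rw [Trace.mk_eq]
    intro u v huv
    have := h u v huv
    rw [proj_cons, proj_cons, this]

theorem Trace.cons_mk (a : V × Bool) (ω : List (V × Bool)) :
    Trace.cons a (Trace.mk ω : Trace Γ) = Trace.mk (a :: ω) := rfl

theorem Trace.ind {p : Trace Γ → Prop} (h : ∀ ω, p (Trace.mk ω)) (x : Trace Γ) : p x :=
  Quotient.inductionOn x h

theorem Trace.cons_injective (a : V × Bool) :
    Function.Injective (Trace.cons a : Trace Γ → Trace Γ) := by
  intro x y
  induction x using Trace.ind with | _ ω =>
  induction y using Trace.ind with | _ ω' =>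
  simp only [Trace.cons_mk, Trace.mk_eq]
  intro h u v huv
  have := h u v huv
  rw [proj_cons, proj_cons] at this
  split_ifs at this
  · exact (List.cons.inj this).2
  · exact this

theorem Trace.cons_comm {a b : V × Bool} (hab : Γ.Adj a.1 b.1) (x : Trace Γ) :
    Trace.cons a (Trace.cons b x) = Trace.cons b (Trace.cons a x) := by
  induction x using Trace.ind with | _ ω =>
  simp only [Trace.cons_mk, Trace.mk_eq]
  intro u v huv
  simp only [proj_cons]
  have hne : a.1 ≠ b.1 := hab.ne
  by_cases h1 : a.1 = u ∨ a.1 = v <;> by_cases h2 : b.1 = u ∨ b.1 = v <;> simp only [h1, h2, if_true, if_false]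
  exfalso
  rcases h1 with h1 | h1 <;> rcases h2 with h2 | h2
  · exact hne (h1.trans h2.symm)
  · exact huv (h1 ▸ h2 ▸ hab)
  · exact huv (h1 ▸ h2 ▸ hab.symm)
  · exact hne (h1.trans h2.symm)

theorem proj_eq_nil {u v : V} {α : List (V × Bool)} (h : ∀ b ∈ α, b.1 ≠ u ∧ b.1 ≠ v) :
    proj u v α = [] := by
  rw [proj, List.filter_eq_nil_iff]
  intro b hb
  have := h b hb
  simp [this.1, this.2]

theorem exists_first_mem {ω : List (V × Bool)} {v : V} (h : proj v v ω ≠ []) :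
    ∃ α b β, ω = α ++ b :: β ∧ b.1 = v ∧ ∀ c ∈ α, c.1 ≠ v := by
  induction ω with
  | nil => simp [proj] at h
  | cons c ω ih =>
    by_cases hc : c.1 = v
    · exact ⟨[], c, ω, rfl, hc, by simp⟩
    · rw [proj_cons, if_neg (by simpa using hc)] at h
      obtain ⟨α, b, β, rfl, hb, hα⟩ := ih h
      refine ⟨c :: α, b, β, rfl, hb, ?_⟩
      intro d hd
      rcases List.mem_cons.1 hd with rfl | hd
      · exact hc
      · exact hα d hd

/-- The projection to `a.1` alone shows that the first letter of `ω'` at that vertex is `a`. If a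
letter `c` in front of it were not adjacent to `a.1`, the projection to `a.1` and `c.1` would begin
with a letter other than `a`. -/
theorem Trace.exists_of_cons_eq {a : V × Bool} {ω ω' : List (V × Bool)}
    (h : (Trace.mk (a :: ω) : Trace Γ) = Trace.mk ω') :
    ∃ α β, ω' = α ++ a :: β ∧ (∀ b ∈ α, Γ.Adj a.1 b.1) ∧
      (Trace.mk ω : Trace Γ) = Trace.mk (α ++ β) := by
  rw [Trace.mk_eq] at h
  have h1 := h a.1 a.1 (SimpleGraph.irrefl _)
  rw [proj_cons, if_pos (Or.inl rfl)] at h1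
  obtain ⟨α, b, β, rfl, hb, hα⟩ := exists_first_mem (ω := ω') (v := a.1) (by rw [← h1]; simp)
  rw [proj_append, proj_eq_nil (fun c hc => ⟨hα c hc, hα c hc⟩), proj_cons,
    if_pos (Or.inl hb), List.nil_append, List.cons.injEq] at h1
  obtain ⟨rfl, -⟩ := h1
  have hadj : ∀ b ∈ α, Γ.Adj a.1 b.1 := by
    intro c hc
    by_contra hac
    have h2 := h a.1 c.1 hac
    rw [proj_cons, if_pos (Or.inl rfl), proj_append] at h2
    have hmem : c ∈ proj a.1 c.1 α := by simp [proj, hc]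
    obtain ⟨d, l, hd⟩ := List.exists_cons_of_ne_nil (List.ne_nil_of_mem hmem)
    rw [hd, List.cons_append, List.cons.injEq] at h2
    have : d ∈ α := by
      have : d ∈ proj a.1 c.1 α := by rw [hd]; simp
      exact List.mem_of_mem_filter this
    exact hα d this (h2.1 ▸ rfl)
  refine ⟨α, β, rfl, hadj, ?_⟩
  rw [Trace.mk_eq]
  intro u v huv
  have h2 := h u v huv
  rw [proj_cons, proj_append, proj_cons] at h2
  rw [proj_append]
  by_cases hc : a.1 = u ∨ a.1 = v
  · rw [if_pos hc, if_pos hc] at h2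
    have hnil : proj u v α = [] := by
      refine proj_eq_nil fun b hb => ⟨?_, ?_⟩
      · rintro rfl
        rcases hc with hc | hc
        · exact (hadj b hb).ne hc
        · exact huv (hc ▸ (hadj b hb).symm)
      · rintro rfl
        rcases hc with hc | hc
        · exact huv (hc ▸ hadj b hb)
        · exact (hadj b hb).ne hc
    rw [hnil] at h2 ⊢
    exact (List.cons.inj h2).2
  · rwa [if_neg hc, if_neg hc] at h2

theorem Trace.mk_append_cons {a : V × Bool} {α β : List (V × Bool)}
    (h : ∀ b ∈ α, Γ.Adj a.1 b.1) :
    (Trace.mk (α ++ a :: β) : Trace Γ) = Trace.cons a (Trace.mk (α ++ β)) := by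
  induction α with
  | nil => rfl
  | cons c α ih =>
    have := ih fun b hb => h b (List.mem_cons_of_mem _ hb)
    rw [List.cons_append, ← Trace.cons_mk, this, Trace.cons_comm (h c (by simp)).symm]
    rfl

/-- Two first letters of a trace are equal or commute. -/
theorem Trace.cons_eq_cons {a b : V × Bool} {x y : Trace Γ}
    (h : Trace.cons a x = Trace.cons b y) :
    a = b ∧ x = y ∨ Γ.Adj a.1 b.1 ∧ ∃ z, x = Trace.cons b z ∧ y = Trace.cons a z := by
  induction x using Trace.ind with | _ ω =>
  induction y using Trace.ind with | _ ω' =>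
  rw [Trace.cons_mk, Trace.cons_mk] at h
  obtain ⟨α, β, h1, hα, h2⟩ := Trace.exists_of_cons_eq h
  cases α with
  | nil =>
    rw [List.nil_append, List.cons.injEq] at h1
    obtain ⟨rfl, rfl⟩ := h1
    exact Or.inl ⟨rfl, h2⟩
  | cons c α =>
    rw [List.cons_append, List.cons.injEq] at h1
    obtain ⟨rfl, rfl⟩ := h1
    refine Or.inr ⟨hα b (by simp), Trace.mk (α ++ β), h2, ?_⟩
    exact Trace.mk_append_cons fun c hc => hα c (List.mem_cons_of_mem _ hc)

/-- A trace is reduced if no representing word has a cancelling pair of neighbouring letters. -/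
def Trace.Reduced (x : Trace Γ) : Prop :=
  ¬∃ α a γ, x = Trace.mk (α ++ a :: bar a :: γ)

theorem Trace.Reduced.of_cons {a : V × Bool} {x : Trace Γ} (h : (Trace.cons a x).Reduced) :
    x.Reduced := by
  rintro ⟨α, b, γ, rfl⟩
  exact h ⟨a :: α, b, γ, rfl⟩

theorem Trace.Reduced.ne_cons {a : V × Bool} {x : Trace Γ} (h : (Trace.cons a x).Reduced)
    (y : Trace Γ) : x ≠ Trace.cons (bar a) y := by
  rintro rfl
  induction y using Trace.ind with | _ γ =>
  exact h ⟨[], a, γ, rfl⟩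

/-- A cancelling pair is traced to the front: by `Trace.cons_eq_cons`, each letter ahead of it
either equals `a`, which leaves the pair inside `x`, or commutes with `a` and can be dropped. -/
theorem Trace.Reduced.cons {a : V × Bool} {x : Trace Γ} (h : x.Reduced)
    (ha : ∀ y, x ≠ Trace.cons (bar a) y) : (Trace.cons a x).Reduced := by
  rintro ⟨α, b, γ, hx⟩
  induction α generalizing x with
  | nil =>
    rcases Trace.cons_eq_cons (y := Trace.mk (bar b :: γ)) hx with ⟨rfl, rfl⟩ | ⟨hab, z, rfl, hz⟩
    · exact ha (Trace.mk γ) rfl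
    · rcases Trace.cons_eq_cons (x := Trace.mk γ) hz with ⟨rfl, -⟩ | ⟨-, z', -, rfl⟩
      · exact hab.ne rfl
      · exact h.ne_cons z' rfl
  | cons c α ih =>
    rcases Trace.cons_eq_cons (y := Trace.mk (α ++ b :: bar b :: γ)) hx with
      ⟨rfl, rfl⟩ | ⟨hac, z, rfl, hz⟩
    · exact h ⟨α, b, γ, rfl⟩
    · refine ih h.of_cons (fun y hy => ?_) hz.symm
      subst hy
      exact ha _ (Trace.cons_comm (a := c) (b := bar a) hac.symm y)

theorem Trace.reduced_nil : (Trace.mk [] : Trace Γ).Reduced := by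
  rintro ⟨α, a, γ, h⟩
  have := Trace.mk_eq.1 h a.1 a.1 (SimpleGraph.irrefl _)
  rw [proj_append, proj_cons, if_pos (Or.inl rfl)] at this
  simp [proj] at this

end Words

end RAAG

/-! ### Normal forms by letting the group act on reduced traces. -/

namespace RAAG

section NormalForm

open scoped Classical

variable {V : Type*} {Γ : SimpleGraph V}

/-- Reduced traces. -/
def RTrace (Γ : SimpleGraph V) : Type _ := {x : Trace Γ // x.Reduced}

/-- `z` is the reduced trace obtained from `x` by multiplying with the letter `a` on the left. -/
def Push (a : V × Bool) (x z : RTrace Γ) : Prop :=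
  z.1 = Trace.cons a x.1 ∨ x.1 = Trace.cons (bar a) z.1

theorem push_bar {a : V × Bool} {x z : RTrace Γ} : Push (bar a) z x ↔ Push a x z := by
  simp only [Push, bar_bar]
  exact or_comm

theorem exists_push (a : V × Bool) (x : RTrace Γ) : ∃ z, Push a x z := by
  by_cases h : ∃ y, x.1 = Trace.cons (bar a) y
  · obtain ⟨y, hy⟩ := h
    exact ⟨⟨y, Trace.Reduced.of_cons (hy ▸ x.2)⟩, Or.inr hy⟩
  · exact ⟨⟨_, x.2.cons fun y hy => h ⟨y, hy⟩⟩, Or.inl rfl⟩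

theorem Push.unique {a : V × Bool} {x z z' : RTrace Γ} (h : Push a x z) (h' : Push a x z') :
    z = z' := by
  have key : ∀ {z z' : RTrace Γ}, z.1 = Trace.cons a x.1 → x.1 = Trace.cons (bar a) z'.1 → False :=
    fun {z z'} h h' => (h ▸ z.2 : (Trace.cons a x.1).Reduced).ne_cons _ h'
  rcases h with h | h <;> rcases h' with h' | h'
  · exact Subtype.ext (h.trans h'.symm)
  · exact (key h h').elim
  · exact (key h' h).elim
  · exact Subtype.ext (Trace.cons_injective _ (h.symm.trans h'))

/-- Multiplication of reduced traces by a letter on the left. -/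
noncomputable def pushPerm (a : V × Bool) : Equiv.Perm (RTrace Γ) where
  toFun x := (exists_push a x).choose
  invFun x := (exists_push (bar a) x).choose
  left_inv x := (exists_push (bar a) _).choose_spec.unique
    (push_bar.2 (exists_push a x).choose_spec)
  right_inv x := (exists_push a _).choose_spec.unique
    (push_bar.1 (by simpa using (exists_push (bar a) x).choose_spec))

theorem push_pushPerm (a : V × Bool) (x : RTrace Γ) : Push a x (pushPerm a x) :=
  (exists_push a x).choose_spec

theorem Push.eq {a : V × Bool} {x z : RTrace Γ} (h : Push a x z) : pushPerm a x = z :=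
  (push_pushPerm a x).unique h

theorem pushPerm_bar (a : V × Bool) : (pushPerm (bar a) : Equiv.Perm (RTrace Γ)) = (pushPerm a)⁻¹ := by
  ext1 x
  rw [Equiv.Perm.eq_inv_iff_eq]
  exact (push_bar.1 (by simpa using push_pushPerm (bar a) x)).eq

/-- Eight cases, according to which of the three pushes cancel; four are contradictory. The result
is the relation that the permutations `pushPerm` must satisfy for `A(Γ)` to act. -/
theorem Push.comm {a b : V × Bool} (hab : Γ.Adj a.1 b.1) {x y y' z : RTrace Γ}
    (h1 : Push b x y) (h2 : Push a y z) (h3 : Push a x y') : Push b y' z := by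
  have hAb : Γ.Adj (bar a).1 b.1 := hab
  have hAB : Γ.Adj (bar a).1 (bar b).1 := hab
  have haB : Γ.Adj a.1 (bar b).1 := hab
  rcases h1 with h1 | h1 <;> rcases h2 with h2 | h2 <;> rcases h3 with h3 | h3
  · left
    rw [h2, h1, h3, Trace.cons_comm hab]
  · exfalso
    rw [h3, Trace.cons_comm hAb.symm] at h1
    exact (h2 ▸ z.2 : (Trace.cons a y.1).Reduced).ne_cons _ h1
  · exfalso
    rcases Trace.cons_eq_cons (h1.symm.trans h2) with ⟨rfl, -⟩ | ⟨-, t, ht, -⟩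
    · exact hab.ne rfl
    · exact (h3 ▸ y'.2 : (Trace.cons a x.1).Reduced).ne_cons _ ht
  · left
    rw [h3, Trace.cons_comm hAb.symm, h2] at h1
    exact Trace.cons_injective _ h1
  · right
    rw [h3, h1, h2, Trace.cons_comm haB]
  · exfalso
    rcases Trace.cons_eq_cons (h1.symm.trans h3) with ⟨hh, -⟩ | ⟨-, t, ht, -⟩
    · have := congrArg Prod.fst hh
      exact hab.ne this.symm
    · exact (h2 ▸ z.2 : (Trace.cons a y.1).Reduced).ne_cons _ ht
  · exfalso
    rw [h2, Trace.cons_comm hAB.symm] at h1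
    exact (h3 ▸ y'.2 : (Trace.cons a x.1).Reduced).ne_cons _ h1
  · right
    rw [h2, Trace.cons_comm hAB.symm, h3] at h1
    exact Trace.cons_injective _ h1

theorem pushPerm_comm {a b : V × Bool} (hab : Γ.Adj a.1 b.1) :
    (pushPerm a * pushPerm b : Equiv.Perm (RTrace Γ)) = pushPerm b * pushPerm a := by
  ext1 x
  exact (Push.comm hab (push_pushPerm b x) (push_pushPerm a _) (push_pushPerm a x)).eq.symm

/-- The action of `A(Γ)` on reduced traces by left multiplication. -/
noncomputable def traceAction : RAAG Γ →* Equiv.Perm (RTrace Γ) :=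
  PresentedGroup.toGroup (f := fun v => pushPerm (v, true)) (by
    rintro r ⟨v, w, hvw, rfl⟩
    have h : (pushPerm (v, true) * pushPerm (w, true) : Equiv.Perm (RTrace Γ)) =
      pushPerm (w, true) * pushPerm (v, true) := pushPerm_comm hvw
    simp [h])

/-- The group element `v^{±1}` of a letter. -/
def letter (a : V × Bool) : RAAG Γ := cond a.2 (of a.1) (of a.1)⁻¹

theorem letter_bar (a : V × Bool) : (letter (bar a) : RAAG Γ) = (letter a)⁻¹ := by
  rcases a with ⟨v, _ | _⟩ <;> simp [letter, bar]

theorem traceAction_letter (a : V × Bool) :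
    traceAction (letter a : RAAG Γ) = pushPerm a := by
  have h : ∀ v : V, traceAction (of v : RAAG Γ) = pushPerm (v, true) := fun v =>
    PresentedGroup.toGroup.of _
  rcases a with ⟨v, _ | _⟩
  · simp only [letter, cond_false, map_inv, h]
    rw [← pushPerm_bar]; rfl
  · simp only [letter, cond_true, h]

theorem letter_comm {a b : V × Bool} (hab : Γ.Adj a.1 b.1) :
    (letter a * letter b : RAAG Γ) = letter b * letter a := by
  have h : Commute (of a.1 : RAAG Γ) (of b.1) := by
    have : (of a.1 * of b.1 * (of a.1)⁻¹ * (of b.1)⁻¹ : RAAG Γ) = 1 :=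
      PresentedGroup.one_of_mem ⟨_, _, hab, rfl⟩
    exact mul_inv_eq_iff_eq_mul.1 (mul_inv_eq_one.1 this)
  rcases a with ⟨v, _ | _⟩ <;> rcases b with ⟨w, _ | _⟩ <;> simp only [letter, cond_true, cond_false]
  · exact h.inv_inv
  · exact h.inv_left
  · exact h.inv_right
  · exact h

/-- The group element represented by a word. -/
def ofWord (ω : List (V × Bool)) : RAAG Γ := (ω.map letter).prod

@[simp] theorem ofWord_nil : (ofWord [] : RAAG Γ) = 1 := rfl

@[simp] theorem ofWord_cons (a : V × Bool) (ω : List (V × Bool)) :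
    (ofWord (a :: ω) : RAAG Γ) = letter a * ofWord ω := by
  simp [ofWord]

theorem ofWord_append (ω ω' : List (V × Bool)) :
    (ofWord (ω ++ ω') : RAAG Γ) = ofWord ω * ofWord ω' := by
  simp [ofWord]

theorem exists_ofWord (g : RAAG Γ) : ∃ ω, ofWord ω = g := by
  have hg : g ∈ Subgroup.closure (Set.range (of : V → RAAG Γ)) :=
    (Subgroup.eq_top_iff' _).1 (PresentedGroup.closure_range_of _) g
  rw [← Subgroup.mem_toSubmonoid, Subgroup.closure_toSubmonoid] at hg
  induction hg using Submonoid.closure_induction with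
  | mem s hs =>
    rcases hs with ⟨v, rfl⟩ | ⟨v, hv⟩
    · exact ⟨[(v, true)], by simp [letter]⟩
    · exact ⟨[(v, false)], by simp [letter, hv]⟩
  | one => exact ⟨[], rfl⟩
  | mul x y _ _ hx hy =>
    obtain ⟨ω, rfl⟩ := hx
    obtain ⟨ω', rfl⟩ := hy
    exact ⟨ω ++ ω', ofWord_append _ _⟩

theorem letter_mul_ofWord {a : V × Bool} {α β : List (V × Bool)}
    (h : ∀ b ∈ α, Γ.Adj a.1 b.1) :
    (ofWord (α ++ a :: β) : RAAG Γ) = letter a * ofWord (α ++ β) := by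
  induction α with
  | nil => simp
  | cons c α ih =>
    rw [List.cons_append, ofWord_cons, ih fun b hb => h b (List.mem_cons_of_mem _ hb),
      ← mul_assoc, letter_comm (h c (by simp)).symm, mul_assoc, List.cons_append, ofWord_cons]

theorem ofWord_eq_of_mk_eq {ω ω' : List (V × Bool)} (h : (Trace.mk ω : Trace Γ) = Trace.mk ω') :
    (ofWord ω : RAAG Γ) = ofWord ω' := by
  induction ω generalizing ω' with
  | nil =>
    cases ω' with
    | nil => rfl
    | cons a ω' =>
      have := Trace.mk_eq.1 h a.1 a.1 (SimpleGraph.irrefl _)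
      rw [proj_cons, if_pos (Or.inl rfl)] at this
      simp [proj] at this
  | cons a ω ih =>
    obtain ⟨α, β, rfl, hα, h'⟩ := Trace.exists_of_cons_eq h
    rw [ofWord_cons, ih h', letter_mul_ofWord hα]

/-- The group element represented by a trace. -/
def Trace.prod (x : Trace Γ) : RAAG Γ :=
  Quotient.liftOn x ofWord fun _ _ h => ofWord_eq_of_mk_eq (Quotient.sound h)

theorem Trace.prod_cons (a : V × Bool) (x : Trace Γ) :
    (Trace.cons a x).prod = letter a * x.prod := by
  induction x using Trace.ind with | _ ω =>
  exact ofWord_cons a ω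

/-- The empty reduced trace. -/
def RTrace.nil : RTrace Γ := ⟨Trace.mk [], Trace.reduced_nil⟩

/-- The reduced trace of a group element. -/
noncomputable def nf (g : RAAG Γ) : RTrace Γ := traceAction g RTrace.nil

theorem nf_one : nf (1 : RAAG Γ) = RTrace.nil := by
  simp [nf]

theorem nf_letter_mul (a : V × Bool) (g : RAAG Γ) : nf (letter a * g) = pushPerm a (nf g) := by
  rw [nf, map_mul, traceAction_letter]; rfl

theorem Push.prod_eq {a : V × Bool} {x z : RTrace Γ} (h : Push a x z) :
    z.1.prod = letter a * x.1.prod := by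
  rcases h with h | h
  · rw [h, Trace.prod_cons]
  · rw [h, Trace.prod_cons, letter_bar, mul_inv_cancel_left]

theorem prod_nf (g : RAAG Γ) : (nf g).1.prod = g := by
  obtain ⟨ω, rfl⟩ := exists_ofWord g
  induction ω with
  | nil => rw [ofWord_nil, nf_one]; rfl
  | cons a ω ih => rw [ofWord_cons, nf_letter_mul, (push_pushPerm a _).prod_eq, ih]

/-- The number of letters of a trace with a given vertex. -/
noncomputable def Trace.cnt (x : Trace Γ) (v : V) : ℕ :=
  Quotient.liftOn x (fun ω => (proj v v ω).length) fun _ _ h =>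
    congrArg List.length (h v v (SimpleGraph.irrefl _))

theorem Trace.cnt_cons (a : V × Bool) (x : Trace Γ) (v : V) :
    (Trace.cons a x).cnt v = (if v = a.1 then 1 else 0) + x.cnt v := by
  induction x using Trace.ind with | _ ω =>
  change (proj v v (a :: ω)).length = _ + (proj v v ω).length
  rw [proj_cons]
  by_cases h : v = a.1
  · subst h
    simp [add_comm]
  · simp [h, Ne.symm h]

/-- The number of letters `v^{±1}` in a reduced word representing `g`. -/
noncomputable def cnt (g : RAAG Γ) (v : V) : ℕ := (nf g).1.cnt v

/-- The product of `g` and `h` is reduced: there is no cancellation. -/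
def Red (g h : RAAG Γ) : Prop := ∀ v, cnt (g * h) v = cnt g v + cnt h v

theorem cnt_one (v : V) : cnt (1 : RAAG Γ) v = 0 := by
  rw [cnt, nf_one]; rfl

theorem cnt_letter_mul (a : V × Bool) (g : RAAG Γ) :
    (∀ v, cnt (letter a * g) v = (if v = a.1 then 1 else 0) + cnt g v) ∨
    (∀ v, cnt g v = (if v = a.1 then 1 else 0) + cnt (letter a * g) v) := by
  simp only [cnt, nf_letter_mul]
  rcases push_pushPerm a (nf g) with h | h
  · left; intro v; rw [h, Trace.cnt_cons]
  · right; intro v; rw [h, Trace.cnt_cons]; rfl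

theorem cnt_letter (a : V × Bool) (v : V) :
    cnt (letter a : RAAG Γ) v = if v = a.1 then 1 else 0 := by
  rcases cnt_letter_mul a (1 : RAAG Γ) with h | h
  · have := h v
    rwa [mul_one, cnt_one, add_zero] at this
  · have := h a.1
    rw [cnt_one, if_pos rfl] at this
    omega

theorem cnt_letter_mul_le (a : V × Bool) (g : RAAG Γ) (v : V) :
    cnt (letter a * g) v ≤ (if v = a.1 then 1 else 0) + cnt g v := by
  rcases cnt_letter_mul a g with h | h
  · exact (h v).le
  · have := h v
    omega

theorem cnt_ofWord_mul_le (ω : List (V × Bool)) (g : RAAG Γ) (v : V) :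
    cnt (ofWord ω * g) v ≤ (proj v v ω).length + cnt g v := by
  induction ω with
  | nil => simp
  | cons a ω ih =>
    rw [ofWord_cons, mul_assoc]
    have h1 := cnt_letter_mul_le a (ofWord ω * g) v
    have h2 : (proj v v (a :: ω)).length = (if v = a.1 then 1 else 0) + (proj v v ω).length :=
      Trace.cnt_cons (Γ := Γ) a (Trace.mk ω) v
    omega

theorem exists_reduced_word (g : RAAG Γ) :
    ∃ ω, ofWord ω = g ∧ ∀ v, cnt g v = (proj v v ω).length := by
  have h1 := prod_nf g
  have h2 : ∀ v, cnt g v = (nf g).1.cnt v := fun v => rfl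
  revert h1 h2
  induction (nf g).1 using Trace.ind with | _ ω =>
  intro h1 h2
  exact ⟨ω, h1, h2⟩

theorem cnt_mul_le (g h : RAAG Γ) (v : V) : cnt (g * h) v ≤ cnt g v + cnt h v := by
  obtain ⟨ω, rfl, hω⟩ := exists_reduced_word g
  rw [hω]
  exact cnt_ofWord_mul_le ω h v

theorem ofWord_inv (ω : List (V × Bool)) :
    (ofWord ω : RAAG Γ)⁻¹ = ofWord (ω.map bar).reverse := by
  induction ω with
  | nil => simp
  | cons a ω ih => simp [ih, ofWord_append, letter_bar]

theorem cnt_inv_le (g : RAAG Γ) (v : V) : cnt g⁻¹ v ≤ cnt g v := by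
  obtain ⟨ω, rfl, hω⟩ := exists_reduced_word g
  rw [hω, ofWord_inv]
  have := cnt_ofWord_mul_le (ω.map bar).reverse (1 : RAAG Γ) v
  rw [mul_one, cnt_one] at this
  refine this.trans (le_of_eq ?_)
  simp only [proj, List.filter_reverse, List.filter_map, Function.comp_def, bar_fst,
    List.length_reverse, List.length_map, add_zero]
  rfl

@[simp] theorem cnt_inv (g : RAAG Γ) (v : V) : cnt g⁻¹ v = cnt g v :=
  le_antisymm (cnt_inv_le g v) (by simpa using cnt_inv_le g⁻¹ v)

/-- The letter `a` is a prefix of `g`. -/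
def Starts (a : V × Bool) (g : RAAG Γ) : Prop := ∃ g', g = letter a * g' ∧ Red (letter a) g'

theorem red_letter {a : V × Bool} {g : RAAG Γ} :
    Red (letter a) g ↔ ∀ v, cnt (letter a * g) v = (if v = a.1 then 1 else 0) + cnt g v := by
  simp only [Red, cnt_letter]

theorem red_or_starts (a : V × Bool) (g : RAAG Γ) : Red (letter a) g ∨ Starts (bar a) g := by
  rcases cnt_letter_mul a g with h | h
  · exact Or.inl (red_letter.2 h)
  · refine Or.inr ⟨letter a * g, by simp [letter_bar], red_letter.2 fun v => ?_⟩
    rw [letter_bar, inv_mul_cancel_left]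
    exact h v

theorem nf_of_red {a : V × Bool} {g : RAAG Γ} (h : Red (letter a) g) :
    (nf (letter a * g)).1 = Trace.cons a (nf g).1 := by
  rcases push_pushPerm a (nf g) with h' | h'
  · rw [nf_letter_mul, h']
  · have h1 : cnt g a.1 = 1 + cnt (letter a * g) a.1 := by
      rw [cnt, h', Trace.cnt_cons, if_pos (by rfl), cnt, nf_letter_mul]
    have h2 := red_letter.1 h a.1
    rw [if_pos rfl] at h2
    omega

theorem red_of_nf {a : V × Bool} {g : RAAG Γ} {x : Trace Γ} (h : (nf g).1 = Trace.cons a x) :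
    ∃ g', g = letter a * g' ∧ Red (letter a) g' ∧ (nf g').1 = x := by
  have hx : x.Reduced := Trace.Reduced.of_cons (h ▸ (nf g).2)
  have h1 : Push (bar a) (nf g) ⟨x, hx⟩ := Or.inr (by simpa using h)
  have h2 : nf (letter (bar a) * g) = ⟨x, hx⟩ := by rw [nf_letter_mul, h1.eq]
  refine ⟨letter (bar a) * g, by simp [letter_bar], red_letter.2 fun v => ?_, by rw [h2]⟩
  rw [letter_bar, mul_inv_cancel_left, ← letter_bar, cnt, cnt, h2, h, Trace.cnt_cons]

theorem exists_starts {g : RAAG Γ} (h : g ≠ 1) : ∃ a, Starts a g := by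
  have h1 := prod_nf g
  obtain ⟨ω, hω⟩ : ∃ ω, (nf g).1 = Trace.mk ω := by
    induction (nf g).1 using Trace.ind with | _ ω => exact ⟨ω, rfl⟩
  cases ω with
  | nil =>
    rw [hω] at h1
    exact (h h1.symm).elim
  | cons a ω =>
    obtain ⟨g', hg, hr, -⟩ := red_of_nf (a := a) (x := Trace.mk ω) hω
    exact ⟨a, g', hg, hr⟩

/-- Two letters that are prefixes of the same element are equal or commute. -/
theorem Starts.eq_or_adj {a b : V × Bool} {g h : RAAG Γ} (hg : Red (letter a) g)
    (hh : Red (letter b) h) (heq : letter a * g = letter b * h) :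
    a = b ∨ Γ.Adj a.1 b.1 ∧ ∃ k, g = letter b * k ∧ h = letter a * k ∧
      Red (letter b) k ∧ Red (letter a) k := by
  have h1 := nf_of_red hg
  rw [heq, nf_of_red hh] at h1
  rcases Trace.cons_eq_cons h1.symm with ⟨h2, -⟩ | ⟨hab, z, h2, h3⟩
  · exact Or.inl h2
  · refine Or.inr ⟨hab, ?_⟩
    obtain ⟨k, rfl, hk, -⟩ := red_of_nf h2
    obtain ⟨k', rfl, hk', -⟩ := red_of_nf h3
    have : k = k' := by
      rw [← mul_assoc, letter_comm hab, mul_assoc] at heq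
      exact mul_left_cancel (mul_left_cancel heq)
    subst this
    exact ⟨k, rfl, rfl, hk, hk'⟩

end NormalForm

end RAAG

/-! ### Reduced products, the prefix order and supports. -/

namespace RAAG

section Lattice

variable {V : Type*} {Γ : SimpleGraph V}

@[simp] theorem cnt_letter_self (a : V × Bool) : cnt (letter a : RAAG Γ) a.1 = 1 := by
  rw [cnt_letter, if_pos rfl]

theorem cnt_letter_of_ne {a : V × Bool} {v : V} (h : v ≠ a.1) :
    cnt (letter a : RAAG Γ) v = 0 := by
  rw [cnt_letter, if_neg h]

theorem eq_of_cnt_letter_ne_zero {a : V × Bool} {v : V} (h : cnt (letter a : RAAG Γ) v ≠ 0) :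
    v = a.1 := by
  by_contra h'
  exact h (cnt_letter_of_ne h')

theorem eq_one_of_cnt {g : RAAG Γ} (h : ∀ v, cnt g v = 0) : g = 1 := by
  by_contra hg
  obtain ⟨a, g', rfl, hr⟩ := exists_starts hg
  have h1 := hr a.1
  rw [h, cnt_letter_self] at h1
  omega

theorem red_one_left (g : RAAG Γ) : Red 1 g := fun v => by rw [one_mul, cnt_one, zero_add]

theorem red_one_right (g : RAAG Γ) : Red g 1 := fun v => by rw [mul_one, cnt_one, add_zero]

theorem Red.inv {g h : RAAG Γ} (hr : Red g h) : Red h⁻¹ g⁻¹ := fun v => by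
  have := hr v
  rw [← mul_inv_rev, cnt_inv, cnt_inv, cnt_inv]
  omega

theorem Red.of_le {g h : RAAG Γ} (hr : ∀ v, cnt g v + cnt h v ≤ cnt (g * h) v) : Red g h :=
  fun v => le_antisymm (cnt_mul_le g h v) (hr v)

theorem Red.right {a b c : RAAG Γ} (h : Red (a * b) c) : Red a b → Red b c := fun h' =>
  .of_le fun v => by
    have h1 := h v
    have h2 := h' v
    have h3 := cnt_mul_le a (b * c) v
    rw [← mul_assoc] at h3
    omega

theorem Red.assoc {a b c : RAAG Γ} (h : Red (a * b) c) : Red a b → Red a (b * c) := fun h' =>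
  .of_le fun v => by
    have h1 := h v
    have h2 := h' v
    have h3 := cnt_mul_le b c v
    rw [← mul_assoc]
    omega

theorem Red.left {a b c : RAAG Γ} (h : Red a (b * c)) : Red b c → Red a b := fun h' =>
  .of_le fun v => by
    have h1 := h v
    have h2 := h' v
    have h3 := cnt_mul_le (a * b) c v
    rw [mul_assoc] at h3
    omega

theorem Red.assoc_symm {a b c : RAAG Γ} (h : Red a (b * c)) : Red b c → Red (a * b) c :=
  fun h' => .of_le fun v => by
    have h1 := h v
    have h2 := h' v
    have h3 := cnt_mul_le a b v
    rw [mul_assoc]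
    omega

/-- Word length. -/
noncomputable def len [Fintype V] (g : RAAG Γ) : ℕ := ∑ v, cnt g v

theorem Red.len [Fintype V] {g h : RAAG Γ} (hr : Red g h) : len (g * h) = len g + len h := by
  simp only [RAAG.len, hr _, Finset.sum_add_distrib]

theorem len_letter [Fintype V] (a : V × Bool) : 0 < len (letter a : RAAG Γ) :=
  Finset.sum_pos' (fun _ _ => Nat.zero_le _) ⟨a.1, Finset.mem_univ _, by simp⟩

theorem len_pos [Fintype V] {g : RAAG Γ} (hg : g ≠ 1) : 0 < len g := by
  by_contra h
  refine hg (eq_one_of_cnt fun v => ?_)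
  have : len g = 0 := by omega
  exact (Finset.sum_eq_zero_iff.1 this) v (Finset.mem_univ _)

theorem letter_induction [Fintype V] {p : RAAG Γ → Prop} (one : p 1)
    (mul : ∀ a g, Red (letter a) g → p g → p (letter a * g)) (g : RAAG Γ) : p g := by
  induction hn : len g using Nat.strong_induction_on generalizing g with
  | _ n ih =>
    by_cases hg : g = 1
    · exact hg ▸ one
    · obtain ⟨a, g', rfl, hr⟩ := exists_starts hg
      have := hr.len
      have := len_letter (Γ := Γ) a
      exact mul a g' hr (ih _ (by omega) _ rfl)

/-- Every vertex of the support of `g` is adjacent to every vertex of the support of `h`. -/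
def AdjSupp (g h : RAAG Γ) : Prop := ∀ u v, cnt g u ≠ 0 → cnt h v ≠ 0 → Γ.Adj u v

theorem AdjSupp.symm {g h : RAAG Γ} (hs : AdjSupp g h) : AdjSupp h g :=
  fun u v hu hv => (hs v u hv hu).symm

theorem AdjSupp.mono {g h g' h' : RAAG Γ} (hs : AdjSupp g h) (hg : ∀ v, cnt g' v ≤ cnt g v)
    (hh : ∀ v, cnt h' v ≤ cnt h v) : AdjSupp g' h' := fun u v hu hv =>
  hs u v (by have := hg u; omega) (by have := hh v; omega)

theorem Red.cnt_le_left {g h : RAAG Γ} (hr : Red g h) (v : V) : cnt g v ≤ cnt (g * h) v := by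
  rw [hr]; omega

theorem Red.cnt_le_right {g h : RAAG Γ} (hr : Red g h) (v : V) : cnt h v ≤ cnt (g * h) v := by
  rw [hr]; omega

theorem AdjSupp.commute_letter [Fintype V] {a : V × Bool} {h : RAAG Γ}
    (hs : AdjSupp (letter a) h) : letter a * h = h * letter a := by
  induction h using letter_induction with
  | one => simp
  | mul b h hr ih =>
    rw [← mul_assoc, letter_comm, mul_assoc, ih (hs.mono (fun _ => le_rfl) hr.cnt_le_right),
      mul_assoc]
    exact hs _ _ (by simp) (by rw [hr, cnt_letter_self]; omega)

theorem AdjSupp.commute [Fintype V] {g h : RAAG Γ} (hs : AdjSupp g h) : g * h = h * g := by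
  induction g using letter_induction with
  | one => simp
  | mul a g hr ih =>
    rw [mul_assoc, ih (hs.mono hr.cnt_le_right fun _ => le_rfl), ← mul_assoc,
      (hs.mono hr.cnt_le_left fun _ => le_rfl).commute_letter, mul_assoc]

theorem adjSupp_letter_mul {a : V × Bool} {g h : RAAG Γ} (ha : AdjSupp (letter a) h)
    (hg : AdjSupp g h) : AdjSupp (letter a * g) h := fun u v hu hv => by
  have := cnt_mul_le (letter a) g u
  by_cases h' : cnt (letter a : RAAG Γ) u = 0
  · exact hg u v (by omega) hv
  · exact ha u v h' hv

theorem adjSupp_letter {a b : V × Bool} : AdjSupp (letter a) (letter b : RAAG Γ) ↔ Γ.Adj a.1 b.1 :=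
  ⟨fun h => h _ _ (by simp) (by simp), fun h u v hu hv => by
    rwa [eq_of_cnt_letter_ne_zero hu, eq_of_cnt_letter_ne_zero hv]⟩

theorem Starts.mul {a : V × Bool} {g h : RAAG Γ} (ha : Starts a g) (hr : Red g h) :
    Starts a (g * h) := by
  obtain ⟨g', rfl, hg'⟩ := ha
  exact ⟨g' * h, by rw [mul_assoc], hr.assoc hg'⟩

/-- A first letter of a reduced product is a first letter of the first factor, or it commutes with
the first factor and is a first letter of the second. -/
theorem starts_mul [Fintype V] {a : V × Bool} {g h : RAAG Γ} (hr : Red g h)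
    (ha : Starts a (g * h)) : Starts a g ∨ AdjSupp (letter a) g ∧ Starts a h := by
  induction g using letter_induction with
  | one => exact Or.inr ⟨fun u v _ hv => (hv (cnt_one v)).elim, by simpa using ha⟩
  | mul b g hbg ih =>
    obtain ⟨k, hk, hak⟩ := ha
    rw [mul_assoc] at hk
    have h1 := hr.assoc hbg
    have h2 := hr.right hbg
    rcases Starts.eq_or_adj h1 hak hk with rfl | ⟨hab, z, hz, -, hz', hz''⟩
    · exact Or.inl ⟨g, rfl, hbg⟩
    · rcases ih h2 ⟨z, hz, hz'⟩ with ⟨g', rfl, hg'⟩ | ⟨h3, h4⟩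
      · refine Or.inl ⟨letter b * g', by rw [← mul_assoc, letter_comm hab, mul_assoc], ?_⟩
        refine .of_le fun v => ?_
        rw [← mul_assoc, letter_comm hab.symm, mul_assoc]
        have := hbg v
        have := hg' v
        have := cnt_mul_le (letter b) g' v
        omega
      · refine Or.inr ⟨?_, h4⟩
        exact (adjSupp_letter_mul (adjSupp_letter.2 hab) h3.symm).symm

theorem Starts.cnt_ne_zero {a : V × Bool} {g : RAAG Γ} (ha : Starts a g) : cnt g a.1 ≠ 0 := by
  obtain ⟨g', rfl, hr⟩ := ha
  rw [hr, cnt_letter_self]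
  omega

/-- If a product is not reduced, then some letter cancels. -/
theorem exists_starts_of_not_red [Fintype V] {g h : RAAG Γ} (hr : ¬Red g h) :
    ∃ a, Starts a g⁻¹ ∧ Starts a h := by
  induction g using letter_induction with
  | one => exact (hr (red_one_left h)).elim
  | mul b g hbg ih =>
    have hinv : Red g⁻¹ (letter b)⁻¹ := hbg.inv
    by_cases h1 : Red g h
    · have h2 : ¬Red (letter b) (g * h) := fun h2 => hr (h2.assoc_symm h1)
      have h3 := (red_or_starts b (g * h)).resolve_left h2
      rcases starts_mul h1 h3 with ⟨g', rfl, hg'⟩ | ⟨h4, h5⟩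
      · exfalso
        have := hbg b.1
        rw [letter_bar, mul_inv_cancel_left, ← letter_bar, hg', cnt_letter_self] at this
        have := cnt_letter_self (Γ := Γ) (bar b)
        rw [bar_fst] at this
        omega
      · refine ⟨bar b, ⟨g⁻¹, ?_, ?_⟩, h5⟩
        · rw [mul_inv_rev, ← letter_bar]
          refine ((AdjSupp.commute_letter (fun u v hu hv => h4 u v hu ?_))).symm
          rwa [cnt_inv] at hv
        · refine .of_le fun v => ?_
          rw [AdjSupp.commute_letter (fun u v hu hv => h4 u v hu (by rwa [cnt_inv] at hv)),
            letter_bar, hinv, add_comm]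
    · obtain ⟨a, h2, h3⟩ := ih h1
      exact ⟨a, by rw [mul_inv_rev]; exact h2.mul hinv, h3⟩

theorem not_red_of_starts {a : V × Bool} {g h : RAAG Γ} (hg : Starts a g⁻¹) (hh : Starts a h) :
    ¬Red g h := by
  obtain ⟨g', hg, hg'⟩ := hg
  obtain ⟨h', rfl, hh'⟩ := hh
  obtain rfl : g = g'⁻¹ * (letter a)⁻¹ := by rw [← mul_inv_rev, ← hg, inv_inv]
  intro hr
  have h1 := hr a.1
  rw [mul_assoc, inv_mul_cancel_left, ← mul_inv_rev, cnt_inv, hg', hh', cnt_letter_self] at h1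
  have h2 := cnt_mul_le g'⁻¹ h' a.1
  rw [cnt_inv] at h2
  omega

/-- Greatest common prefixes exist. -/
theorem exists_meet [Fintype V] (g h : RAAG Γ) :
    ∃ d a b, g = d * a ∧ h = d * b ∧ Red d a ∧ Red d b ∧ Red a⁻¹ b := by
  induction hn : len g using Nat.strong_induction_on generalizing g h with
  | _ n ih =>
    by_cases hr : Red g⁻¹ h
    · exact ⟨1, g, h, by simp, by simp, red_one_left _, red_one_left _, hr⟩
    · obtain ⟨x, h1, h2⟩ := exists_starts_of_not_red hr
      rw [inv_inv] at h1
      obtain ⟨g', rfl, hg'⟩ := h1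
      obtain ⟨h', rfl, hh'⟩ := h2
      have := hg'.len
      have := len_letter (Γ := Γ) x
      obtain ⟨d, a, b, rfl, rfl, hda, hdb, hab⟩ := ih _ (by omega) g' h' rfl
      exact ⟨letter x * d, a, b, by group, by group, hg'.assoc_symm hda, hh'.assoc_symm hdb, hab⟩

/-- Two prefixes of the same element with trivial meet commute. -/
theorem adjSupp_of_mul_eq_mul [Fintype V] {a a' b b' : RAAG Γ} (h : a * a' = b * b')
    (ha : Red a a') (hb : Red b b') (hab : Red a⁻¹ b) :
    AdjSupp a b ∧ ∃ c, a' = b * c ∧ b' = a * c ∧ Red b c ∧ Red a c := by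
  induction a using letter_induction generalizing b' with
  | one =>
    exact ⟨fun u v hu => (hu (cnt_one u)).elim, b', by simpa using h, by simp, hb, red_one_left _⟩
  | mul x a hxa ih =>
    have hx : Starts x (b * b') := by
      rw [← h]
      exact Starts.mul ⟨a, rfl, hxa⟩ ha
    rcases starts_mul hb hx with h1 | ⟨h1, b'', rfl, hb''⟩
    · exact (not_red_of_starts (by rw [inv_inv]; exact ⟨a, rfl, hxa⟩) h1 hab).elim
    · have hxb := h1.commute
      have h2 : a * a' = b * b'' := by
        rw [mul_assoc, ← mul_assoc b, ← hxb, mul_assoc] at h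
        exact mul_left_cancel h
      have h3 : Red a⁻¹ b := .of_le fun v => by
        have h4 := hab v
        have h5 : (letter x * a)⁻¹ * b = a⁻¹ * b * (letter x)⁻¹ := by
          rw [mul_inv_rev, mul_assoc, mul_assoc, mul_right_inj, eq_mul_inv_iff_mul_eq, mul_assoc,
            ← hxb, inv_mul_cancel_left]
        have h6 := cnt_mul_le (a⁻¹ * b) (letter x)⁻¹ v
        have h7 := hxa v
        rw [h5, cnt_inv] at h4
        rw [cnt_inv] at h6 ⊢
        omega
      have h8 : Red b b'' := .of_le fun v => by
        have h9 := hb v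
        have h10 := hb'' v
        rw [← mul_assoc, ← hxb, mul_assoc] at h9
        have h11 := cnt_mul_le (letter x) (b * b'') v
        omega
      obtain ⟨h4, c, rfl, rfl, h5, h6⟩ := ih h2 (ha.right hxa) h8 h3
      exact ⟨adjSupp_letter_mul h1 h4, c, rfl, by group, h5, hb''.assoc_symm h6⟩

/-- A prefix of a reduced product is a prefix of the first factor times a prefix of the second. -/
theorem exists_split [Fintype V] {x x' t g : RAAG Γ} (h : x * x' = t * g) (hx : Red x x')
    (ht : Red t g) :
    ∃ x₁ x₂ t' g', x = x₁ * x₂ ∧ t = x₁ * t' ∧ g = x₂ * g' ∧ x' = t' * g' ∧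
      Red x₁ x₂ ∧ Red x₁ t' ∧ Red x₂ g' ∧ Red t' g' ∧ AdjSupp x₂ t' := by
  obtain ⟨d, a, b, rfl, rfl, hda, hdb, hab⟩ := exists_meet x t
  have h1 : a * x' = b * g := by
    rw [mul_assoc, mul_assoc] at h
    exact mul_left_cancel h
  obtain ⟨h2, c, rfl, rfl, h3, h4⟩ := adjSupp_of_mul_eq_mul h1 (hx.right hda) (ht.right hdb) hab
  exact ⟨d, a, b, c, rfl, rfl, rfl, rfl, hda, hdb, h4, h3, h2⟩

/-- `x` is a prefix of `w`. -/
def Le (x w : RAAG Γ) : Prop := ∃ y, w = x * y ∧ Red x y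

theorem Le.mul {x w y : RAAG Γ} (h : Le x w) (hr : Red w y) : Le x (w * y) := by
  obtain ⟨z, rfl, hz⟩ := h
  exact ⟨z * y, by rw [mul_assoc], hr.assoc hz⟩

theorem Le.trans {x y z : RAAG Γ} (h : Le x y) (h' : Le y z) : Le x z := by
  obtain ⟨t, rfl, ht⟩ := h'
  exact h.mul ht

theorem Le.cnt_le {x w : RAAG Γ} (h : Le x w) (v : V) : cnt x v ≤ cnt w v := by
  obtain ⟨t, rfl, ht⟩ := h
  exact ht.cnt_le_left v

theorem Le.exists_meet [Fintype V] {x y w : RAAG Γ} (hx : Le x w) (hy : Le y w) :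
    ∃ d a b, x = d * a ∧ y = d * b ∧ Red d a ∧ Red d b ∧ AdjSupp a b := by
  obtain ⟨x', rfl, hx'⟩ := hx
  obtain ⟨y', h, hy'⟩ := hy
  obtain ⟨d, a, b, t, rfl, rfl, -, -, h1, h2, -, -, h3⟩ := exists_split h hx' hy'
  exact ⟨d, a, b, rfl, rfl, h1, h2, h3⟩

theorem Le.of_cnt_le [Fintype V] {x y w : RAAG Γ} (hx : Le x w) (hy : Le y w)
    (h : ∀ v, cnt x v ≤ cnt y v) : Le x y := by
  obtain ⟨d, a, b, rfl, rfl, h1, h2, h3⟩ := hx.exists_meet hy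
  obtain rfl : a = 1 := by
    refine eq_one_of_cnt fun v => ?_
    by_contra hv
    have h4 := h v
    rw [h1, h2] at h4
    exact (h3 v v hv (by omega)).ne rfl
  exact ⟨b, by simp, by simpa using h2⟩

theorem Le.eq_of_cnt_eq [Fintype V] {x y w : RAAG Γ} (hx : Le x w) (hy : Le y w)
    (h : ∀ v, cnt x v = cnt y v) : x = y := by
  obtain ⟨b, rfl, hb⟩ := hx.of_cnt_le hy fun v => (h v).le
  have : b = 1 := eq_one_of_cnt fun v => by
    have := h v
    have := hb v
    omega
  simp [this]

/-- Letters with non-adjacent vertices are totally ordered in a group element. -/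
theorem Le.cnt_le_cnt [Fintype V] {x y w : RAAG Γ} (hx : Le x w) (hy : Le y w) {u v : V}
    (huv : ¬Γ.Adj u v) (h : cnt x u < cnt y u) : cnt x v ≤ cnt y v := by
  obtain ⟨d, a, b, rfl, rfl, h1, h2, h3⟩ := hx.exists_meet hy
  by_contra h4
  rw [h1, h2] at h4 h
  exact huv (h3 v u (by omega) (by omega)).symm

/-- The support of an element of the centralizer of `v` lies in the star of `v`. -/
theorem eq_or_adj_of_commute [Fintype V] {v : V} {g : RAAG Γ}
    (h : letter (v, true) * g = g * letter (v, true)) {u : V} (hu : cnt g u ≠ 0) :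
    u = v ∨ Γ.Adj v u := by
  set a : V × Bool := (v, true) with ha
  induction hn : len g using Nat.strong_induction_on generalizing g with
  | _ n ih =>
    have main : ∀ b : V × Bool, b.1 = v → letter b * g = g * letter b → Starts b g →
        u = v ∨ Γ.Adj v u := by
      rintro b hb hcomm ⟨g', rfl, hg'⟩
      by_cases hub : u = v
      · exact Or.inl hub
      · have h1 := hg' u
        rw [cnt_letter_of_ne (by rwa [hb])] at h1
        have := hg'.len
        have := len_letter (Γ := Γ) b
        refine ih (len g') (by omega) (by omega) ?_ rfl
        have h2 : letter b * g' = g' * letter b := by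
          rw [mul_assoc] at hcomm
          exact mul_left_cancel hcomm
        have h3 : Commute (letter b) g' := h2
        rcases b with ⟨w, _ | _⟩
        · obtain rfl : w = v := hb
          have h4 : (letter (w, false) : RAAG Γ) = (letter a)⁻¹ := letter_bar (w, true)
          rw [h4] at h3
          exact (Commute.inv_left_iff.1 h3)
        · obtain rfl : w = v := hb
          exact h3
    -- If `a * g = g * a` is reduced, then `a` either starts `g` and can be stripped off, or is
    -- adjacent to the whole support of `g`. Otherwise `bar a` starts `g` and is stripped off
    -- instead.
    rcases red_or_starts a g with h1 | h1
    · have h2 : Red g (letter a) := .of_le fun w => by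
        rw [← h, h1, add_comm]
      rcases starts_mul h2 ⟨g, h.symm, h1⟩ with h3 | ⟨h3, -⟩
      · exact main a rfl h h3
      · exact Or.inr (h3 v u (by rw [cnt_letter_self a]; omega) hu)
    · refine main (bar a) rfl ?_ h1
      rw [letter_bar]
      exact (Commute.inv_left (show Commute (letter a) g from h))

/-- This makes being a star-word a condition on the support, so that it survives deleting letters.
-/
theorem isStarWord_iff [Fintype V] {g : RAAG Γ} :
    IsStarWord g ↔ ∃ v, ∀ u, cnt g u ≠ 0 → u = v ∨ Γ.Adj v u := by
  refine exists_congr fun v => ?_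
  rw [Subgroup.mem_centralizer_singleton_iff]
  constructor
  · intro h u hu
    exact eq_or_adj_of_commute (by simpa [letter] using h.symm) hu
  · intro h
    induction g using letter_induction with
    | one => simp
    | mul a g hr ih =>
      have h1 := ih fun u hu => h u (by have := hr u; omega)
      have h2 : Commute (letter a) (of v : RAAG Γ) := by
        rcases h a.1 (by rw [hr, cnt_letter_self]; omega) with h3 | h3
        · rcases a with ⟨w, _ | _⟩
          · obtain rfl : w = v := h3
            exact (Commute.refl _).inv_left
          · obtain rfl : w = v := h3
            exact Commute.refl _
        · exact letter_comm (a := a) (b := (v, true)) h3.symm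
      exact (h2.mul_left h1 : Commute _ _)

end Lattice

end RAAG

/-! ### Star length of reduced products, rich supports and cyclic reduction. -/

namespace RAAG

section StarLength

variable {V : Type*} {Γ : SimpleGraph V}

theorem starLength_le_one {g : RAAG Γ} (h : IsStarWord g) : starLength g ≤ 1 :=
  starLength_le ⟨[g], rfl, by simpa using h, by simp⟩

theorem IsStarWord.of_cnt_le [Fintype V] {g h : RAAG Γ} (hg : IsStarWord g)
    (hle : ∀ v, cnt h v ≤ cnt g v) : IsStarWord h := by
  rw [isStarWord_iff] at hg ⊢
  obtain ⟨v, hv⟩ := hg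
  exact ⟨v, fun u hu => hv u (by have := hle u; omega)⟩

/-- `g` is a reduced product of `n` star-words. -/
inductive GeoStar : ℕ → RAAG Γ → Prop
  | one : GeoStar 0 1
  | mul {n : ℕ} {t g : RAAG Γ} : IsStarWord t → Red t g → GeoStar n g → GeoStar (n + 1) (t * g)

theorem GeoStar.starLength_le {n : ℕ} {g : RAAG Γ} (h : GeoStar n g) : starLength g ≤ n := by
  induction h with
  | one => rw [starLength_one]
  | mul ht _ _ ih =>
    have := starLength_mul_le _ _ |>.trans (add_le_add (starLength_le_one ht) ih)
    omega

/-- Splitting `a`, `b`, `c` along `t * g` gives `t = a₀ * b₀ * t₂` and `g = a₁ * b₁ * g₄`, where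
`a₁` commutes with `t₂`. Then `a * c = (a₀ * t₂) * (a₁ * g₄)`: the first factor is still a
star-word, and the second arises from `g` by deleting `b₁`. -/
theorem GeoStar.delete [Fintype V] {n : ℕ} {a b c : RAAG Γ} (h : GeoStar n (a * b * c))
    (hab : Red a b) (habc : Red (a * b) c) (hac : Red a c) : GeoStar n (a * c) := by
  induction n generalizing a b c with
  | zero =>
    generalize hx : a * b * c = x at h
    cases h
    have : a * c = 1 := eq_one_of_cnt fun v => by
      have h1 := habc v
      have h2 := hab v
      have h3 := hac v
      rw [hx, cnt_one] at h1
      omega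
    rw [this]
    exact .one
  | succ n ih =>
    generalize hx : a * b * c = x at h
    cases h with
    | @mul _ t g ht htg hg =>
    rw [mul_assoc] at hx
    obtain ⟨a₀, a₁, t₁, g₃, rfl, rfl, rfl, h1, ha, ht₁, hg₃, htg₁, hadj⟩ :=
      exists_split hx (habc.assoc hab) htg
    obtain ⟨b₀, b₁, t₂, g₄, rfl, rfl, rfl, rfl, hb, ht₂, hg₄, htg₂, hadj₂⟩ :=
      exists_split h1 (habc.right hab) htg₁
    have hcomm : a₁ * t₂ = t₂ * a₁ := (hadj.mono (fun _ => le_rfl) ht₂.cnt_le_right).commute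
    have heq : a₀ * a₁ * (t₂ * g₄) = (a₀ * t₂) * (a₁ * g₄) := by
      rw [mul_assoc, ← mul_assoc a₁, hcomm]
      group
    have key : ∀ v, cnt ((a₀ * t₂) * (a₁ * g₄)) v = cnt a₀ v + cnt a₁ v + cnt t₂ v + cnt g₄ v := by
      intro v
      rw [← heq, hac, ha, htg₂]
      omega
    have hle : ∀ v, cnt (a₀ * t₂) v ≤ cnt a₀ v + cnt t₂ v := cnt_mul_le _ _
    have hle' : ∀ v, cnt (a₁ * g₄) v ≤ cnt a₁ v + cnt g₄ v := cnt_mul_le _ _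
    rw [heq]
    refine .mul (ht.of_cnt_le fun v => ?_) (.of_le fun v => ?_) (ih (b := b₁) ?_ ?_ ?_ (.of_le fun v => ?_))
    · have := ht₁ v
      have := ht₂ v
      have := hle v
      omega
    · have := key v
      have := hle v
      have := hle' v
      omega
    · rw [mul_assoc]; exact hg
    · exact hg₃.left hg₄
    · exact hg₃.assoc_symm hg₄
    · have := key v
      have := hle v
      have := cnt_mul_le (a₀ * t₂) (a₁ * g₄) v
      omega

/-- A shortest factorization can be made reduced: whatever cancels between a star-word and the
product after it is deleted from both, by `GeoStar.delete` in the latter. -/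
theorem geoStar_starLength [Fintype V] (g : RAAG Γ) : GeoStar (starLength g) g := by
  obtain ⟨l, hl, hs, rfl⟩ := isProdStarWords_starLength g
  rw [← hl]
  clear hl
  induction l with
  | nil => exact .one
  | cons s l ih =>
    have ih := ih fun t ht => hs t (List.mem_cons_of_mem _ ht)
    obtain ⟨d, a, b, h1, h2, hda, hdb, hab⟩ := exists_meet s⁻¹ l.prod
    rw [h2] at ih
    have h3 : GeoStar l.length b := by
      have := GeoStar.delete (a := 1) (b := d) (c := b) (by simpa using ih) (red_one_left _)
        (by simpa using hdb) (red_one_left _)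
      simpa using this
    have h4 : s = a⁻¹ * d⁻¹ := by rw [← mul_inv_rev, ← h1, inv_inv]
    rw [List.prod_cons, h2, h4, mul_assoc, inv_mul_cancel_left, List.length_cons]
    refine .mul ((hs s (by simp)).of_cnt_le fun v => ?_) hab h3
    rw [h4]
    exact hda.inv.cnt_le_left v

theorem starLength_delete_le [Fintype V] {a b c : RAAG Γ} (hab : Red a b) (habc : Red (a * b) c)
    (hac : Red a c) : starLength (a * c) ≤ starLength (a * b * c) :=
  ((geoStar_starLength _).delete hab habc hac).starLength_le

theorem Red.starLength_le_left [Fintype V] {a b : RAAG Γ} (h : Red a b) :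
    starLength a ≤ starLength (a * b) := by
  simpa using starLength_delete_le h (red_one_right _) (red_one_right _)

theorem Red.starLength_le_right [Fintype V] {a b : RAAG Γ} (h : Red a b) :
    starLength b ≤ starLength (a * b) := by
  simpa using starLength_delete_le (red_one_left a) (by simpa using h) (red_one_left b)

theorem Le.starLength_le [Fintype V] {x w : RAAG Γ} (h : Le x w) : starLength x ≤ starLength w := by
  obtain ⟨y, rfl, hy⟩ := h
  exact hy.starLength_le_left

/-- A vertex in the support of `a` would have the whole support of `b` in its star. -/
theorem AdjSupp.eq_one [Fintype V] {a b : RAAG Γ} (h : AdjSupp a b) (hb : 2 ≤ starLength b) :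
    a = 1 := by
  refine eq_one_of_cnt fun v => ?_
  by_contra hv
  have := starLength_le_one (g := b) (isStarWord_iff.2 ⟨v, fun u hu => Or.inr (h v u hv hu)⟩)
  omega

/-- A prefix of small star length lies below any prefix of larger star length. -/
theorem Le.of_starLength [Fintype V] {x y w : RAAG Γ} (hx : Le x w) (hy : Le y w)
    (h : starLength x + 2 ≤ starLength y) : Le x y := by
  obtain ⟨d, a, b, rfl, rfl, h1, h2, h3⟩ := hx.exists_meet hy
  have h4 := starLength_mul_le d b
  have h5 := h1.starLength_le_left
  obtain rfl := h3.eq_one (by omega)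
  exact ⟨b, by simp, by simpa using h2⟩

/-- The support of `g` is contained neither in a star nor in a join. -/
def Rich (g : RAAG Γ) : Prop :=
  (∀ v, ∃ u, cnt g u ≠ 0 ∧ u ≠ v ∧ ¬Γ.Adj v u) ∧
    ∀ T : Set V, (∃ u ∈ T, cnt g u ≠ 0) → (∃ u ∉ T, cnt g u ≠ 0) →
      ∃ u ∈ T, ∃ v ∉ T, cnt g u ≠ 0 ∧ cnt g v ≠ 0 ∧ ¬Γ.Adj u v

theorem exists_mul_of_join [Fintype V] (T : Set V) (g : RAAG Γ)
    (h : ∀ u ∈ T, ∀ v ∉ T, cnt g u ≠ 0 → cnt g v ≠ 0 → Γ.Adj u v) :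
    ∃ g₁ g₂, g = g₁ * g₂ ∧ (∀ u, cnt g₁ u ≠ 0 → u ∈ T ∧ cnt g u ≠ 0) ∧
      ∀ u, cnt g₂ u ≠ 0 → u ∉ T ∧ cnt g u ≠ 0 := by
  induction g using letter_induction with
  | one => exact ⟨1, 1, by simp, by simp [cnt_one], by simp [cnt_one]⟩
  | mul a g hr ih =>
    have hmono : ∀ u, cnt g u ≠ 0 → cnt (letter a * g) u ≠ 0 := fun u hu => by
      have := hr u
      omega
    have ha : cnt (letter a * g) a.1 ≠ 0 := by rw [hr, cnt_letter_self]; omega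
    obtain ⟨g₁, g₂, hg, h1, h2⟩ :=
      ih fun u hu v hv hgu hgv => h u hu v hv (hmono u hgu) (hmono v hgv)
    by_cases haT : a.1 ∈ T
    · refine ⟨letter a * g₁, g₂, by rw [hg, mul_assoc], fun u hu => ?_,
        fun u hu => ⟨(h2 u hu).1, hmono u (h2 u hu).2⟩⟩
      by_cases hua : u = a.1
      · subst hua; exact ⟨haT, ha⟩
      · have := cnt_mul_le (letter a) g₁ u
        rw [cnt_letter_of_ne hua] at this
        have := h1 u (by omega)
        exact ⟨this.1, hmono u this.2⟩
    · refine ⟨g₁, letter a * g₂, ?_, fun u hu => ⟨(h1 u hu).1, hmono u (h1 u hu).2⟩,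
        fun u hu => ?_⟩
      · rw [← mul_assoc, ← AdjSupp.commute_letter, hg, mul_assoc]
        intro u v hu hv
        rw [eq_of_cnt_letter_ne_zero hu]
        exact (h v (h1 v hv).1 a.1 haT (hmono v (h1 v hv).2) ha).symm
      · by_cases hua : u = a.1
        · subst hua; exact ⟨haT, ha⟩
        · have := cnt_mul_le (letter a) g₂ u
          rw [cnt_letter_of_ne hua] at this
          have := h2 u (by omega)
          exact ⟨this.1, hmono u this.2⟩

/-- Support in a star means star length at most 1. Support in a join splits `g` into two factors,
each in the star of a vertex from the other side, so star length is at most 2. -/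
theorem rich_of_three_le [Fintype V] {g : RAAG Γ} (h : 3 ≤ starLength g) : Rich g := by
  constructor
  · intro v
    by_contra! hv
    have := starLength_le_one (g := g) (isStarWord_iff.2 ⟨v, fun u hu => by
      by_contra! h'
      exact h'.2 (hv u hu h'.1)⟩)
    omega
  · rintro T ⟨u₀, hu₀, hu⟩ ⟨v₀, hv₀, hv⟩
    by_contra! hT
    obtain ⟨g₁, g₂, rfl, h1, h2⟩ := exists_mul_of_join T g hT
    have h3 := starLength_le_one (g := g₁) (isStarWord_iff.2 ⟨v₀, fun u hu' => Or.inr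
      (hT u (h1 u hu').1 v₀ hv₀ (h1 u hu').2 hv).symm⟩)
    have h4 := starLength_le_one (g := g₂) (isStarWord_iff.2 ⟨u₀, fun u hu' => Or.inr
      (hT u₀ hu₀ u (h2 u hu').1 hu (h2 u hu').2)⟩)
    have := starLength_mul_le g₁ g₂
    omega

/-- If the support of `g` lies on one side of `T`, a vertex of the support of `h` on the other side
still has a non-neighbour in the support of `g`, because that support is contained in no star. -/
theorem Rich.of_support {g h : RAAG Γ} (hg : Rich g) (hgh : ∀ v, cnt g v ≠ 0 → cnt h v ≠ 0) :
    Rich h := by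
  refine ⟨fun v => ?_, ?_⟩
  · obtain ⟨u, hu, hu'⟩ := hg.1 v
    exact ⟨u, hgh u hu, hu'⟩
  · rintro T ⟨u₀, hu₀, hu⟩ ⟨v₀, hv₀, hv⟩
    by_cases h1 : ∃ u ∈ T, cnt g u ≠ 0
    · by_cases h2 : ∃ u ∉ T, cnt g u ≠ 0
      · obtain ⟨u, hu, v, hv, h3, h4, h5⟩ := hg.2 T h1 h2
        exact ⟨u, hu, v, hv, hgh u h3, hgh v h4, h5⟩
      · obtain ⟨w, hw, -, hw'⟩ := hg.1 v₀
        push Not at h2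
        exact ⟨w, by by_contra hwT; exact hw (h2 w hwT), v₀, hv₀, hgh w hw, hv, fun h => hw' h.symm⟩
    · obtain ⟨w, hw, -, hw'⟩ := hg.1 u₀
      push Not at h1
      exact ⟨u₀, hu₀, w, fun hwT => hw (h1 w hwT), hu, hgh w hw, hw'⟩

theorem Rich.exists_cnt_ne_zero {g : RAAG Γ} [Nonempty V] (hg : Rich g) : ∃ u, cnt g u ≠ 0 := by
  obtain ⟨u, hu, -⟩ := hg.1 (Classical.arbitrary V)
  exact ⟨u, hu⟩

/-! ### Powers -/

/-- A cancelling letter would either cancel already in `e * e`, or be adjacent to the whole support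
of `e` while occurring in `e`. -/
theorem Red.pow [Fintype V] {e : RAAG Γ} (h : Red e e) (n : ℕ) : Red e (e ^ n) := by
  induction n with
  | zero => rw [pow_zero]; exact red_one_right e
  | succ n ih =>
    by_contra hn
    obtain ⟨a, h1, h2⟩ := exists_starts_of_not_red hn
    rw [pow_succ'] at h2
    rcases starts_mul ih h2 with h3 | ⟨h3, -⟩
    · exact not_red_of_starts h1 h3 h
    · have := h1.cnt_ne_zero
      rw [cnt_inv] at this
      exact (h3 a.1 a.1 (by simp) this).ne rfl

theorem cnt_pow [Fintype V] {e : RAAG Γ} (h : Red e e) (n : ℕ) (v : V) :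
    cnt (e ^ n) v = n * cnt e v := by
  induction n with
  | zero => rw [pow_zero, cnt_one, zero_mul]
  | succ n ih => rw [pow_succ', h.pow n, ih, add_mul, one_mul, add_comm]

theorem red_pow_pow [Fintype V] {e : RAAG Γ} (h : Red e e) (m n : ℕ) : Red (e ^ m) (e ^ n) :=
  fun v => by rw [← pow_add, cnt_pow h, cnt_pow h, cnt_pow h, add_mul]

theorem Red.mul_pow [Fintype V] {c e : RAAG Γ} (he : Red e e) (h : Red c e) (n : ℕ) :
    Red c (e ^ n) := by
  by_contra hn
  obtain ⟨a, h1, h2⟩ := exists_starts_of_not_red hn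
  cases n with
  | zero => exact h2.cnt_ne_zero (by rw [pow_zero, cnt_one])
  | succ n =>
    rw [pow_succ'] at h2
    rcases starts_mul (he.pow n) h2 with h3 | ⟨h3, h4⟩
    · exact not_red_of_starts h1 h3 h
    · have := h4.cnt_ne_zero
      rw [cnt_pow he] at this
      exact (h3 a.1 a.1 (by simp) (right_ne_zero_of_mul this)).ne rfl

/-- `c * e * c⁻¹` is a reduced product with `e` cyclically reduced. -/
structure CycRed (c e : RAAG Γ) : Prop where
  red_self : Red e e
  red_mul : Red c e
  red_mul_inv : Red (c * e) c⁻¹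

theorem CycRed.pow [Fintype V] {c e : RAAG Γ} (h : CycRed c e) (n : ℕ) (hn : n ≠ 0) :
    Red c (e ^ n) ∧ Red (c * e ^ n) c⁻¹ := by
  have h1 : Red c (e ^ n) := h.red_self.mul_pow h.red_mul n
  refine ⟨h1, ?_⟩
  by_contra hr
  obtain ⟨a, h2, h3⟩ := exists_starts_of_not_red hr
  have he' : Red e⁻¹ e⁻¹ := h.red_self.inv
  have hce : Red c e⁻¹ := by
    have := (h.red_mul_inv.right h.red_mul).inv
    rwa [inv_inv] at this
  have h4 : Red c (e⁻¹ ^ n) := he'.mul_pow hce n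
  rw [mul_inv_rev, ← inv_pow] at h2
  have h5 : Red (e⁻¹ ^ n) c⁻¹ := by
    have := h1.inv
    rwa [← inv_pow] at this
  rcases starts_mul h5 h2 with h6 | ⟨h6, -⟩
  · exact not_red_of_starts h3 h6 h4
  -- The cancelling letter commutes with `e`, so it would already cancel across `e` in `c * e *
  -- c⁻¹`.
  · have h7 : AdjSupp (letter a) e := h6.mono (fun _ => le_rfl) fun v => by
      rw [cnt_pow he', cnt_inv]
      exact Nat.le_mul_of_pos_left _ (Nat.pos_of_ne_zero hn)
    obtain ⟨c', hc, hc'⟩ := h3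
    obtain rfl : c = c'⁻¹ * (letter a)⁻¹ := by rw [← mul_inv_rev, ← hc, inv_inv]
    have h8 := h.red_mul_inv a.1
    have h9 := h.red_mul a.1
    have h10 : c'⁻¹ * (letter a)⁻¹ * e * (c'⁻¹ * (letter a)⁻¹)⁻¹ = c'⁻¹ * e * c' := by
      have h12 : (letter a)⁻¹ * e * letter a = e := by
        rw [mul_assoc, ← h7.commute, inv_mul_cancel_left]
      calc _ = c'⁻¹ * ((letter a)⁻¹ * e * letter a) * c' := by group
        _ = _ := by rw [h12]
    have h11 : cnt (c'⁻¹ * (letter a)⁻¹)⁻¹ a.1 = 1 + cnt c' a.1 := by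
      rw [hc, hc', cnt_letter_self]
    rw [h10, h9, ← cnt_inv (c'⁻¹ * (letter a)⁻¹), h11] at h8
    have h13 := cnt_mul_le (c'⁻¹ * e) c' a.1
    have h14 := cnt_mul_le c'⁻¹ e a.1
    rw [cnt_inv] at h14
    omega

/-- Every element is conjugate, by a reduced product, to a cyclically reduced element. -/
theorem exists_cycRed [Fintype V] (g : RAAG Γ) : ∃ c e, g = c * e * c⁻¹ ∧ CycRed c e := by
  induction hn : len g using Nat.strong_induction_on generalizing g with
  | _ n ih =>
    by_cases hg : Red g g
    · exact ⟨1, g, by simp, hg, red_one_left g, by simpa using red_one_right g⟩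
    · obtain ⟨a, h1, h2⟩ := exists_starts_of_not_red hg
      obtain ⟨g₁, rfl, hg₁⟩ := h2
      rw [mul_inv_rev] at h1
      rcases starts_mul hg₁.inv h1 with h3 | ⟨-, h3⟩
      · obtain ⟨k, hk, hk'⟩ := h3
        obtain rfl : g₁ = k⁻¹ * (letter a)⁻¹ := by rw [← mul_inv_rev, ← hk, inv_inv]
        have h4 : Red k⁻¹ (letter a)⁻¹ := hk'.inv
        have h5 := hg₁.len
        have h6 := h4.len
        have h7 := len_letter (Γ := Γ) a
        obtain ⟨c, e, hce, h8⟩ := ih (len k⁻¹) (by omega) k⁻¹ rfl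
        have key : ∀ v, cnt (letter a * (k⁻¹ * (letter a)⁻¹)) v =
            2 * cnt (letter a : RAAG Γ) v + 2 * cnt c v + cnt e v := fun v => by
          rw [hg₁, h4, hce, h8.red_mul_inv, h8.red_mul, cnt_inv, cnt_inv]
          omega
        have heq : letter a * (k⁻¹ * (letter a)⁻¹) = letter a * c * e * (letter a * c)⁻¹ := by
          rw [hce]
          group
        have h9 := cnt_mul_le (letter a) c
        have h10 := cnt_mul_le (letter a * c) e
        have h11 := cnt_mul_le (letter a * c * e) (letter a * c)⁻¹
        refine ⟨letter a * c, e, heq, h8.red_self, .of_le fun v => ?_, .of_le fun v => ?_⟩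
        · have := key v
          have := h9 v
          have := h10 v
          have := h11 v
          rw [← heq, cnt_inv] at this
          omega
        · have := key v
          have := h9 v
          have := h10 v
          rw [← heq, cnt_inv]
          omega
      -- Here `a` would start its own inverse, forcing `a = bar a`.
      · exfalso
        obtain ⟨k, hk, hk'⟩ := h3
        obtain rfl : k = 1 := eq_one_of_cnt fun v => by
          have := hk' v
          rw [← hk, cnt_inv] at this
          omega
        rcases Starts.eq_or_adj (red_one_right (letter a)) (red_one_right (letter (bar a)))
          (by rw [← hk, letter_bar, mul_one]) with h4 | ⟨h4, -⟩
        · exact bar_ne a h4.symm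
        · exact h4.ne rfl

end StarLength

end RAAG

/-! ### Linear growth of the star length of powers. -/

namespace RAAG

section TranslationLength

variable {V : Type*} {Γ : SimpleGraph V}

/-- The non-commutation graph on the support of `e`. -/
def suppGraph (e : RAAG Γ) : SimpleGraph V where
  Adj u v := u ≠ v ∧ ¬Γ.Adj u v ∧ cnt e u ≠ 0 ∧ cnt e v ≠ 0
  symm := ⟨fun _ _ h => ⟨h.1.symm, fun h' => h.2.1 h'.symm, h.2.2.2, h.2.2.1⟩⟩
  loopless := ⟨fun _ h => h.1 rfl⟩

/-- In the non-commutation graph there is an injective path from `u` to the complement of the star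
of `v`, all of whose vertices but the last lie in that star. -/
theorem Rich.exists_path {e : RAAG Γ} (he : Rich e) {u : V} (hu : cnt e u ≠ 0) (v : V) :
    ∃ (d : ℕ) (w : ℕ → V), w 0 = u ∧ (∀ j < d, (suppGraph e).Adj (w j) (w (j + 1))) ∧
      (∀ j < d, w j = v ∨ Γ.Adj v (w j)) ∧ ¬(w d = v ∨ Γ.Adj v (w d)) ∧ cnt e (w d) ≠ 0 ∧
      Set.InjOn w {j | j ≤ d} := by
  classical
  obtain ⟨x, hx, hxv, hvx⟩ := he.1 v
  have hreach : (suppGraph e).Reachable u x := by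
    by_contra hux
    obtain ⟨a, ha, b, hb, h1, h2, h3⟩ :=
      he.2 {y | (suppGraph e).Reachable u y} ⟨u, .refl u, hu⟩ ⟨x, hux, hx⟩
    have hab : a ≠ b := by
      rintro rfl
      exact hb ha
    have hadj : (suppGraph e).Adj a b := ⟨hab, h3, h1, h2⟩
    exact hb (ha.trans hadj.reachable)
  obtain ⟨p, hp⟩ := hreach.exists_isPath
  have hex : ∃ d, d ≤ p.length ∧ ¬(p.getVert d = v ∨ Γ.Adj v (p.getVert d)) :=
    ⟨p.length, le_rfl, by rw [p.getVert_length]; tauto⟩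
  have h1 := Nat.find_spec hex
  have hadj : ∀ j < Nat.find hex, (suppGraph e).Adj (p.getVert j) (p.getVert (j + 1)) :=
    fun j hj => p.adj_getVert_succ (by omega)
  refine ⟨Nat.find hex, p.getVert, p.getVert_zero, hadj, fun j hj => ?_, h1.2, ?_, ?_⟩
  · by_contra h
    exact Nat.find_min hex hj ⟨by omega, h⟩
  · cases hd : Nat.find hex with
    | zero => rwa [p.getVert_zero]
    | succ d => exact (hadj d (by omega)).2.2.2
  · intro i hi j hj hij
    simp only [Set.mem_ofPred_eq] at hi hj
    exact hp.getVert_injOn (by simp only [Set.mem_ofPred_eq]; omega)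
      (by simp only [Set.mem_ofPred_eq]; omega) hij

theorem add_card_le_of_injOn [Fintype V] {d : ℕ} {w : ℕ → V} (hw : Set.InjOn w {j | j ≤ d}) (s : Finset V)
    (hs : ∀ j ≤ d, w j ∉ s) : d + 1 + s.card ≤ Fintype.card V := by
  classical
  have h1 : ((Finset.range (d + 1)).image w).card = d + 1 := by
    rw [Finset.card_image_of_injOn, Finset.card_range]
    intro i hi j hj
    simp only [Finset.coe_range, Set.mem_Iio] at hi hj
    exact hw (by simp only [Set.mem_ofPred_eq]; omega) (by simp only [Set.mem_ofPred_eq]; omega)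
  have h2 : Disjoint ((Finset.range (d + 1)).image w) s := by
    rw [Finset.disjoint_left]
    intro x hx
    obtain ⟨j, hj, rfl⟩ := Finset.mem_image.1 hx
    exact hs j (by have := Finset.mem_range.1 hj; omega)
  have h3 := Finset.card_le_univ ((Finset.range (d + 1)).image w ∪ s)
  rw [Finset.card_union_of_disjoint h2] at h3
  omega

/-- A path as in `Rich.exists_path` that has at least two edges avoids the vertex `v`. -/
theorem path_ne {e : RAAG Γ} {d : ℕ} {w : ℕ → V} {v : V} (hd : 2 ≤ d)
    (hadj : ∀ j < d, (suppGraph e).Adj (w j) (w (j + 1)))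
    (hst : ∀ j < d, w j = v ∨ Γ.Adj v (w j)) (hv : ¬(w d = v ∨ Γ.Adj v (w d))) {j : ℕ}
    (hj : j ≤ d) : w j ≠ v := by
  rintro rfl
  rcases Nat.eq_zero_or_pos j with rfl | hj0
  · have h1 := hadj 0 (by omega)
    rcases hst 1 (by omega) with h | h
    · exact h1.1 h.symm
    · exact h1.2.1 h
  · rcases hj.eq_or_lt with rfl | hjd
    · exact hv (Or.inl rfl)
    · have h1 := hadj (j - 1) (by omega)
      rw [Nat.sub_add_cancel hj0] at h1
      rcases hst (j - 1) (by omega) with h | h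
      · exact h1.1 h
      · exact h1.2.1 h.symm

/-- For `d ≥ 2` the `d + 1` distinct vertices avoid `v`, so `d ≤ |V| - 2`. The 4 in the maximum
covers short paths. -/
theorem path_length_le [Fintype V] {e : RAAG Γ} {d : ℕ} {w : ℕ → V} {v : V}
    (hadj : ∀ j < d, (suppGraph e).Adj (w j) (w (j + 1)))
    (hst : ∀ j < d, w j = v ∨ Γ.Adj v (w j)) (hv : ¬(w d = v ∨ Γ.Adj v (w d)))
    (hw : Set.InjOn w {j | j ≤ d}) : d ≤ max 4 (Fintype.card V) - 2 := by
  by_cases hd : 2 ≤ d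
  · have := add_card_le_of_injOn hw {v} fun j hj => by
      simpa using path_ne hd hadj hst hv hj
    rw [Finset.card_singleton] at this
    omega
  · omega

/-- The number of full periods of `e` in the `u`-letters of `x`. -/
noncomputable def level (e x : RAAG Γ) (u : V) : ℕ := cnt x u / cnt e u

/-- Compare `x` with the prefix `e ^ (level e x u + 1)`: it has more `u`-letters than `x`, hence at
least as many `v`-letters, since `u` and `v` do not commute. -/
theorem level_le [Fintype V] {e x : RAAG Γ} {k : ℕ} (he : Red e e) (hx : Le x (e ^ k)) {u v : V}
    (h : (suppGraph e).Adj u v) : level e x v ≤ level e x u + 1 := by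
  obtain ⟨-, huv, hu, hv⟩ := h
  have hv' := hx.cnt_le v
  rw [cnt_pow he] at hv'
  rw [level, Nat.div_le_iff_le_mul_add_pred (Nat.pos_of_ne_zero hv)]
  suffices h : cnt x v ≤ (level e x u + 1) * cnt e v by
    rw [mul_comm] at h; omega
  by_cases hk : k ≤ level e x u + 1
  · exact hv'.trans (Nat.mul_le_mul_right _ hk)
  · have h1 : Le (e ^ (level e x u + 1)) (e ^ k) :=
      ⟨e ^ (k - (level e x u + 1)), by rw [← pow_add]; congr 1; omega, red_pow_pow he _ _⟩
    have h2 : cnt x u < cnt (e ^ (level e x u + 1)) u := by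
      rw [cnt_pow he, mul_comm]
      exact Nat.lt_mul_div_succ _ (Nat.pos_of_ne_zero hu)
    have := hx.cnt_le_cnt h1 huv h2
    rwa [cnt_pow he] at this

theorem level_path_le [Fintype V] {e x : RAAG Γ} {k : ℕ} (he : Red e e) (hx : Le x (e ^ k)) {d : ℕ}
    {w : ℕ → V} (hadj : ∀ j < d, (suppGraph e).Adj (w j) (w (j + 1))) {i j : ℕ} (hij : i ≤ j)
    (hj : j ≤ d) : level e x (w j) ≤ level e x (w i) + (j - i) := by
  induction j, hij using Nat.le_induction with
  | base => omega
  | succ j hij ih =>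
    have := ih (by omega)
    have := level_le he hx (hadj j (by omega))
    omega

theorem level_mul_eq {e x t : RAAG Γ} (h : Red x t) {u v : V}
    (ht : ∀ u, cnt t u ≠ 0 → u = v ∨ Γ.Adj v u) (hu : ¬(u = v ∨ Γ.Adj v u)) :
    level e (x * t) u = level e x u := by
  have : cnt t u = 0 := by
    by_contra h
    exact hu (ht u h)
  rw [level, level, h, this, add_zero]

/-- A star-word in the star of `v` leaves the level unchanged outside that star. A path from `u` to
such a vertex has length at most `max 4 |V| - 2`, so each star-word accounts for at most that many
periods. -/
theorem le_level_add [Fintype V] {e : RAAG Γ} (he : Red e e) (hr : Rich e) {k n : ℕ} {x g : RAAG Γ}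
    (hg : GeoStar n g) (hxg : x * g = e ^ k) (hred : Red x g) {u : V} (hu : cnt e u ≠ 0) :
    k ≤ level e x u + n * (max 4 (Fintype.card V) - 2) := by
  induction hg generalizing x u with
  | one =>
    rw [mul_one] at hxg
    rw [level, hxg, cnt_pow he, Nat.mul_div_cancel _ (Nat.pos_of_ne_zero hu)]
    omega
  | @mul n t g ht htg hg ih =>
    obtain ⟨v, hv⟩ := isStarWord_iff.1 ht
    obtain ⟨d, w, rfl, hadj, hst, hd, hed, hinj⟩ := hr.exists_path hu v
    have hxt := hred.left htg
    have h1 := ih (x := x * t) (by rw [← hxg, mul_assoc]) (hred.assoc_symm htg) hed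
    rw [level_mul_eq hxt hv hd] at h1
    have h2 := level_path_le he ⟨_, hxg.symm, hred⟩ hadj (Nat.zero_le d) le_rfl
    have h3 := path_length_le hadj hst hd hinj
    rw [add_mul, one_mul]
    omega

/-- A lower bound for the star length of the powers of a cyclically reduced element. -/
theorem lt_starLength_pow [Fintype V] [Nonempty V] {e : RAAG Γ} (he : Red e e) (hr : Rich e) {k : ℕ} (hk : k ≠ 0) :
    k < (starLength (e ^ k) - 1) * (max 4 (Fintype.card V) - 2) := by
  obtain ⟨u, hu⟩ := hr.exists_cnt_ne_zero
  have hgeo := geoStar_starLength (e ^ k)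
  generalize starLength (e ^ k) = l at hgeo
  generalize hx : e ^ k = x at hgeo
  cases hgeo with
  | one =>
    have := cnt_pow he k u
    rw [hx, cnt_one] at this
    exact (Nat.mul_ne_zero hk hu this.symm).elim
  | @mul n t g ht htg hg =>
    obtain ⟨v₁, hv₁⟩ := isStarWord_iff.1 ht
    obtain ⟨u₁, hu₁, h1, h2⟩ := hr.1 v₁
    have h3 : ¬(u₁ = v₁ ∨ Γ.Adj v₁ u₁) := by tauto
    have h4 : level e t u₁ = 0 := by
      have := level_mul_eq (e := e) (red_one_left t) hv₁ h3
      rwa [one_mul, level, level, cnt_one, Nat.zero_div] at this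
    cases hg with
    | one =>
      have := le_level_add he hr .one (x := t) hx.symm htg hu₁
      omega
    | @mul n t₂ g ht₂ htg₂ hg =>
      obtain ⟨v₂, hv₂⟩ := isStarWord_iff.1 ht₂
      obtain ⟨d, w, rfl, hadj, hst, hd, hed, hinj⟩ := hr.exists_path hu₁ v₂
      have htt := htg.left htg₂
      have hle : Le t (e ^ k) := ⟨_, hx, htg⟩
      have h5 := le_level_add he hr hg (x := t * t₂) (by rw [hx, mul_assoc])
        (htg.assoc_symm htg₂) hed
      rw [level_mul_eq htt hv₂ hd] at h5
      have h6 := level_path_le he hle hadj (Nat.zero_le d) le_rfl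
      have h7 := path_length_le hadj hst hd hinj
      -- This saves one over the path bound and makes the final inequality strict. Equality would
      -- force every `w j` with `j > 0` to occur in `t`, hence to lie in the star of `v₁`. The path
      -- would then avoid both `v₁` and `v₂` and be too long to be injective.
      have h8 : level e t (w d) < max 4 (Fintype.card V) - 2 := by
        by_contra h8
        have hd2 : 2 ≤ d := by omega
        have hmem : ∀ j, 0 < j → j ≤ d → w j = v₁ ∨ Γ.Adj v₁ (w j) := by
          intro j hj hjd
          refine hv₁ _ fun h0 => ?_
          have h9 := level_path_le he hle hadj hjd le_rfl
          have h10 : level e t (w j) = 0 := by rw [level, h0, Nat.zero_div]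
          omega
        have hne₁ : ∀ j ≤ d, w j ≠ v₁ := by
          rintro j hj rfl
          rcases Nat.eq_zero_or_pos j with rfl | hj0
          · exact h3 (Or.inl rfl)
          · by_cases hj1 : j = 1
            · subst hj1
              have h9 := hadj 1 (by omega)
              rcases hmem 2 (by omega) hd2 with h | h
              · exact h9.1 h.symm
              · exact h9.2.1 h
            · have h9 := hadj (j - 1) (by omega)
              rw [Nat.sub_add_cancel hj0] at h9
              rcases hmem (j - 1) (by omega) (by omega) with h | h
              · exact h9.1 h
              · exact h9.2.1 h.symm
        have hv : v₁ ≠ v₂ := by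
          rintro rfl
          exact hd (hmem d (by omega) le_rfl)
        classical
        have h9 := add_card_le_of_injOn hinj {v₁, v₂} fun j hj => by
          simp only [Finset.mem_insert, Finset.mem_singleton, not_or]
          exact ⟨hne₁ j hj, path_ne hd2 hadj hst hd hj⟩
        rw [Finset.card_pair hv] at h9
        omega
      have h10 : n + 1 + 1 - 1 = n + 1 := rfl
      rw [h10, add_mul, one_mul]
      omega

end TranslationLength

end RAAG

/-! ### Sliding a long element along itself. -/

namespace RAAG

section Shift

variable {V : Type*} {Γ : SimpleGraph V}

/-- The conjugation `h' * w = w * h` shifts the middle part `m` of `w`. -/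
structure ShiftDecomp (w h h' p p' m s s' : RAAG Γ) : Prop where
  eq : w = p * m * s
  eq' : w = p' * m * s'
  left_eq : h' = p * p'⁻¹
  right_eq : h = s⁻¹ * s'
  red : Red p m
  red_mul : Red (p * m) s
  red' : Red p' m
  red_mul' : Red (p' * m) s'
  red_left : Red p p'⁻¹
  red_right : Red s⁻¹ s'

theorem ShiftDecomp.symm {w h h' p p' m s s' : RAAG Γ} (D : ShiftDecomp w h h' p p' m s s') :
    ShiftDecomp w h⁻¹ h'⁻¹ p' p m s' s where
  eq := D.eq'
  eq' := D.eq
  left_eq := by rw [D.left_eq]; group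
  right_eq := by rw [D.right_eq]; group
  red := D.red'
  red_mul := D.red_mul'
  red' := D.red
  red_mul' := D.red_mul
  red_left := by simpa using D.red_left.inv
  red_right := by simpa using D.red_right.inv

theorem GeoStar.exists_mul {i j : ℕ} {g : RAAG Γ} (hg : GeoStar (i + j) g) :
    ∃ x y, g = x * y ∧ Red x y ∧ GeoStar i x ∧ GeoStar j y := by
  induction i generalizing g with
  | zero => exact ⟨1, g, by simp, red_one_left g, .one, by simpa using hg⟩
  | succ i ih =>
    have h1 : i + 1 + j = i + j + 1 := by omega
    rw [h1] at hg
    cases hg with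
    | mul ht hr hg =>
      obtain ⟨x, y, rfl, hxy, hx, hy⟩ := ih hg
      have h2 := hr.left hxy
      exact ⟨_, y, by rw [mul_assoc], hr.assoc_symm hxy, .mul ht h2 hx, hy⟩

variable [Fintype V]

/-- Here `q` is the meet of `w` and `w * h`, and `p` is the meet of `q` and `h'`, with `h' = p * k`
and `p' = k⁻¹`. The length of `w` leaves star length at least 2 for `m`. -/
theorem exists_shiftDecomp {w h h' : RAAG Γ} {ρ : ℕ} (hw : h' * w = w * h)
    (hh : starLength h ≤ ρ) (hh' : starLength h' ≤ ρ) (hρ : 2 * ρ + 2 ≤ starLength w) :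
    ∃ p p' m s s', ShiftDecomp w h h' p p' m s s' := by
  obtain ⟨q, s, s', hq, hq', hqs, hqs', hss⟩ := exists_meet w (w * h)
  obtain ⟨p, m, k, hp, rfl, hpm, hpk, hmk⟩ := exists_meet q h'
  have hhe : h = s⁻¹ * s' := by
    rw [hq, mul_assoc] at hq'
    rw [← mul_left_cancel hq']
    group
  have hp1 : starLength p ≤ ρ := hpk.starLength_le_left.trans hh'
  have hs1 : starLength s ≤ ρ := by
    rw [← starLength_inv s]
    refine le_trans ?_ hh
    rw [hhe]
    exact hss.starLength_le_left
  have hm : 2 ≤ starLength m := by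
    have h1 := starLength_mul_le q s
    have h2 := starLength_mul_le p m
    rw [← hq] at h1
    rw [← hp] at h2
    omega
  subst hp
  have hms' : Red m s' := hqs'.right hpm
  have hkm : Red k⁻¹ m := by simpa using hmk.inv
  -- Anything cancelling between `k⁻¹` and `m * s'` would have to pass through `m`, and is therefore
  -- trivial.
  have hkms : Red k⁻¹ (m * s') := by
    obtain ⟨d, a, b, h1, rfl, hda, hdb, hab⟩ := exists_meet (m * s') k
    have h3 : Red m⁻¹ d := .of_le fun v => by
      have h4 := hmk v
      have h5 := hdb v
      have h6 := cnt_mul_le (m⁻¹ * d) b v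
      rw [← mul_assoc] at h4
      omega
    obtain ⟨h4, -⟩ := adjSupp_of_mul_eq_mul h1 hms' hda h3
    obtain rfl := h4.symm.eq_one hm
    rw [one_mul] at h1 ⊢
    rw [h1]
    simpa using hab.inv
  have hw' : w = k⁻¹ * m * s' := by
    rw [hq', mul_assoc, mul_assoc] at hw
    have := mul_left_cancel hw
    rw [mul_assoc, ← this]
    group
  exact ⟨p, k⁻¹, m, s, s', hq, hw', by group, hhe, hpm, hqs, hkm, hkms.assoc_symm hms',
    by simpa using hpk, hss⟩

namespace ShiftDecomp

variable {w h h' p p' m s s' : RAAG Γ}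

theorem starLength_p_le (D : ShiftDecomp w h h' p p' m s s') : starLength p ≤ starLength h' := by
  rw [D.left_eq]
  exact D.red_left.starLength_le_left

theorem starLength_s_le (D : ShiftDecomp w h h' p p' m s s') : starLength s ≤ starLength h := by
  rw [D.right_eq, ← starLength_inv s]
  exact D.red_right.starLength_le_left

theorem starLength_le (D : ShiftDecomp w h h' p p' m s s') :
    starLength w ≤ starLength h' + starLength m + starLength h := by
  have h1 := starLength_mul_le (p * m) s
  have h2 := starLength_mul_le p m
  rw [← D.eq] at h1
  have := D.starLength_p_le
  have := D.starLength_s_le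
  omega

/-- Far from both ends, `x = p * z` with `z` a prefix of `m`, so `h'⁻¹ * x = p' * z` is read off
from the second factorization of `w`. -/
theorem le_inv_mul (D : ShiftDecomp w h h' p p' m s s') {x y : RAAG Γ} (hxy : w = x * y)
    (hr : Red x y) (hx : starLength h' + 2 ≤ starLength x) (hy : starLength h + 2 ≤ starLength y) :
    Le (h'⁻¹ * x) w ∧ ∀ v, cnt (h'⁻¹ * x) v + cnt p v = cnt x v + cnt p' v := by
  have hp : Le p w := ⟨m * s, by rw [D.eq, mul_assoc], D.red_mul.assoc D.red⟩
  have := D.starLength_p_le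
  have := D.starLength_s_le
  obtain ⟨z, rfl, hz⟩ := hp.of_starLength ⟨y, hxy, hr⟩ (by omega)
  have hs : Le s⁻¹ w⁻¹ := ⟨(p * m)⁻¹, by rw [D.eq, mul_inv_rev], D.red_mul.inv⟩
  obtain ⟨t, ht, ht'⟩ := hs.of_starLength (y := y⁻¹) ⟨(p * z)⁻¹, by rw [hxy, mul_inv_rev], hr.inv⟩
    (by rw [starLength_inv, starLength_inv]; omega)
  obtain rfl : y = t⁻¹ * s := by rw [← inv_inv y, ht]; group
  have hts : Red t⁻¹ s := by simpa using ht'.inv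
  have hm : m = z * t⁻¹ := by
    have h1 := D.eq
    rw [hxy, ← mul_assoc, mul_assoc p] at h1
    exact (mul_left_cancel (mul_right_cancel h1)).symm
  have hzt : Red z t⁻¹ := (hr.left hts).right hz
  have hpz : Red p' z := by
    have h1 := D.red'
    rw [hm] at h1
    exact h1.left hzt
  have heq : h'⁻¹ * (p * z) = p' * z := by rw [D.left_eq]; group
  refine ⟨⟨t⁻¹ * s', by rw [heq, D.eq', hm]; group, ?_⟩, fun v => ?_⟩
  · rw [heq]
    have h1 := D.red'
    have h2 := D.red_mul'
    rw [hm] at h1 h2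
    have h3 : Red (p' * z) t⁻¹ := h1.assoc_symm hzt
    rw [← mul_assoc] at h2
    exact h2.assoc h3
  · rw [heq, hpz, hz]
    omega

end ShiftDecomp

theorem exists_mul_of_le_starLength {i j : ℕ} {g : RAAG Γ} (h : i + j ≤ starLength g) :
    ∃ x y, g = x * y ∧ Red x y ∧ i ≤ starLength x ∧ j ≤ starLength y := by
  have h1 := geoStar_starLength g
  rw [show starLength g = i + (starLength g - i) by omega] at h1
  obtain ⟨x, y, hg, hxy, hx, hy⟩ := h1.exists_mul
  have h2 := hx.starLength_le
  have h3 := hy.starLength_le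
  have h4 := starLength_mul_le x y
  rw [← hg] at h4
  exact ⟨x, y, hg, hxy, by omega, by omega⟩

/-- Elements moving both ends of a long element by a small amount commute. -/
theorem commute_of_le_starLength {w h₁ h₁' h₂ h₂' : RAAG Γ} {ρ : ℕ} (hw₁ : h₁' * w = w * h₁)
    (hw₂ : h₂' * w = w * h₂) (hh₁ : starLength h₁ ≤ ρ) (hh₁' : starLength h₁' ≤ ρ)
    (hh₂ : starLength h₂ ≤ ρ) (hh₂' : starLength h₂' ≤ ρ) (hρ : 4 * ρ + 4 ≤ starLength w) :
    h₁' * h₂' = h₂' * h₁' := by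
  obtain ⟨p₁, p₁', m₁, s₁, s₁', D₁⟩ := exists_shiftDecomp hw₁ hh₁ hh₁' (by omega)
  obtain ⟨p₂, p₂', m₂, s₂, s₂', D₂⟩ := exists_shiftDecomp hw₂ hh₂ hh₂' (by omega)
  -- One shift costs at most ρ on either side, so 2ρ + 2 leaves the ρ + 2 needed for a second.
  obtain ⟨x, y, hxy, hr, hx, hy⟩ :=
    exists_mul_of_le_starLength (i := 2 * ρ + 2) (j := 2 * ρ + 2) (g := w) (by omega)
  have step : ∀ {h h' : RAAG Γ}, starLength h ≤ ρ → starLength h' ≤ ρ → h' * w = w * h →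
      ∀ {x' y'}, h'⁻¹ * x = x' → w = x' * y' → ρ + 2 ≤ starLength x' ∧ ρ + 2 ≤ starLength y' := by
    intro h h' hh hh' hw x' y' hx' hw'
    have h1 := starLength_mul_le h' x'
    rw [← hx', mul_inv_cancel_left, hx'] at h1
    have h2 : y' = y * h := by
      calc y' = x'⁻¹ * w := by rw [hw', inv_mul_cancel_left]
        _ = x⁻¹ * (h' * w) := by rw [← hx']; group
        _ = y * h := by rw [hw, hxy]; group
    have h3 := starLength_mul_le y' h⁻¹
    rw [h2, mul_inv_cancel_right, ← h2, starLength_inv] at h3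
    omega
  obtain ⟨⟨y₁, h1, hr1⟩, h2⟩ := D₁.le_inv_mul hxy hr (by omega) (by omega)
  obtain ⟨⟨y₂, h3, hr2⟩, h4⟩ := D₂.le_inv_mul hxy hr (by omega) (by omega)
  obtain ⟨h5, h6⟩ := step hh₁ hh₁' hw₁ rfl h1
  obtain ⟨h7, h8⟩ := step hh₂ hh₂' hw₂ rfl h3
  obtain ⟨h9, h10⟩ := D₂.le_inv_mul h1 hr1 (by omega) (by omega)
  obtain ⟨h11, h12⟩ := D₁.le_inv_mul h3 hr2 (by omega) (by omega)
  -- Both orders of shifting give prefixes of `w` with equal counts, hence equal elements.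
  have h13 := h9.eq_of_cnt_eq h11 fun v => by
    have := h2 v
    have := h4 v
    have := h10 v
    have := h12 v
    omega
  rw [← mul_assoc, ← mul_assoc] at h13
  have := congrArg (fun z => z⁻¹) (mul_right_cancel h13)
  simpa using this

/-- If the letter `a` can be appended to the prefix `y`, then moving from `y` to a prefix with more
`v`-letters has to increase the number of `a`-letters, unless `a` and `v` commute. -/
theorem cnt_lt_of_cnt_lt {w x y : RAAG Γ} {a : V × Bool} {v : V} (hx : Le x w)
    (hy : Le (y * letter a) w) (hr : Red y (letter a)) (hav : ¬Γ.Adj a.1 v) (hne : v ≠ a.1)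
    (h : cnt y v < cnt x v) : cnt y a.1 < cnt x a.1 := by
  by_contra h1
  have h2 := hx.cnt_le_cnt hy hav (by rw [hr, cnt_letter_self]; omega)
  rw [hr, cnt_letter_of_ne hne] at h2
  omega

theorem exists_letter {g : RAAG Γ} {u : V} (hu : cnt g u ≠ 0) :
    ∃ x a y, g = x * letter a * y ∧ a.1 = u ∧ Red x (letter a) ∧ Red (x * letter a) y := by
  induction g using letter_induction with
  | one => exact (hu (cnt_one u)).elim
  | mul b g hr ih =>
    by_cases hb : b.1 = u
    · exact ⟨1, b, g, by simp, hb, red_one_left _, by simpa using hr⟩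
    · rw [hr, cnt_letter_of_ne (Ne.symm hb), zero_add] at hu
      obtain ⟨x, a, y, rfl, ha, h1, h2⟩ := ih hu
      have h3 := hr.left h2
      refine ⟨letter b * x, a, y, by group, ha, ?_, ?_⟩
      · exact h3.assoc_symm h1
      · rw [mul_assoc (letter b)]
        exact hr.assoc_symm h2

namespace ShiftDecomp

variable {w h h' p p' m s s' : RAAG Γ}

/-- At a letter `a` of `m = x * a * y` with vertex `u`, compare the prefixes `p * x` and `p' * x *
a` of `w`. The first has more `v`-letters, so it cannot have fewer `u`-letters. -/
theorem cnt_lt (D : ShiftDecomp w h h' p p' m s s') {u v : V} (hu : cnt m u ≠ 0)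
    (huv : ¬Γ.Adj u v) (hne : v ≠ u) (hv : cnt p' v < cnt p v) : cnt p' u < cnt p u := by
  obtain ⟨x, a, y, hm, rfl, h1, h2⟩ := exists_letter hu
  have hp : Red p (x * letter a) := by
    have := D.red
    rw [hm] at this
    exact this.left h2
  have hp' : Red p' (x * letter a) := by
    have := D.red'
    rw [hm] at this
    exact this.left h2
  have hpx := hp.left h1
  have hpx' := hp'.left h1
  have le1 : Le (p * x) w := by
    have h3 : Le (p * x) (p * m) := by
      refine ⟨letter a * y, by rw [hm]; group, ?_⟩
      have := D.red
      rw [hm, mul_assoc] at this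
      exact this.assoc_symm (h2.assoc h1)
    exact h3.trans ⟨s, D.eq, D.red_mul⟩
  have le2 : Le (p' * x * letter a) w := by
    have h3 : Le (p' * x * letter a) (p' * m) := by
      refine ⟨y, by rw [hm]; group, ?_⟩
      have := D.red'
      rw [hm] at this
      rw [mul_assoc p']
      exact this.assoc_symm h2
    exact h3.trans ⟨s', D.eq', D.red_mul'⟩
  have := cnt_lt_of_cnt_lt le1 le2 (hp'.assoc_symm h1) huv hne (by rw [hpx, hpx']; omega)
  rw [hpx, hpx'] at this
  omega

/-- Richness spreads the inequality by `cnt_lt`: from `v` to a non-neighbour in the support of `m`,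
then to the whole support, which is not a join. An opposite inequality at any vertex would spread
likewise and contradict this. -/
theorem le_of_cnt_lt (D : ShiftDecomp w h h' p p' m s s') (hm : Rich m) {v : V}
    (hv : cnt p' v < cnt p v) : Le p' p ∧ ∀ u, cnt m u ≠ 0 → cnt p' u < cnt p u := by
  have hpos : ∀ u, cnt m u ≠ 0 → cnt p' u < cnt p u := by
    by_contra! hex
    obtain ⟨u₀, hu₀, hu₀'⟩ := hex
    obtain ⟨u, hu, huv, hvu⟩ := hm.1 v
    have h1 := D.cnt_lt hu (fun h => hvu h.symm) huv.symm hv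
    obtain ⟨a, ha, b, hb, -, hb', hab⟩ := hm.2 {u | cnt p' u < cnt p u} ⟨u, h1, hu⟩
      ⟨u₀, by simpa using hu₀', hu₀⟩
    refine hb (D.cnt_lt hb' (fun h => hab h.symm) ?_ ha)
    rintro rfl
    exact hb ha
  have hp : Le p w := ⟨m * s, by rw [D.eq, mul_assoc], D.red_mul.assoc D.red⟩
  have hp' : Le p' w := ⟨m * s', by rw [D.eq', mul_assoc], D.red_mul'.assoc D.red'⟩
  refine ⟨hp'.of_cnt_le hp fun v' => ?_, hpos⟩
  by_contra! hv'
  obtain ⟨u, hu, huv, hvu⟩ := hm.1 v'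
  have h1 := D.symm.cnt_lt hu (fun h => hvu h.symm) huv.symm hv'
  have h2 := hpos u hu
  omega

theorem trichotomy (D : ShiftDecomp w h h' p p' m s s') (hm : Rich m) (hne : h' ≠ 1) :
    (Le p' p ∧ ∀ u, cnt m u ≠ 0 → cnt p' u < cnt p u) ∨
      (Le p p' ∧ ∀ u, cnt m u ≠ 0 → cnt p u < cnt p' u) := by
  by_cases h1 : ∃ v, cnt p' v < cnt p v
  · obtain ⟨v, hv⟩ := h1
    exact Or.inl (D.le_of_cnt_lt hm hv)
  by_cases h2 : ∃ v, cnt p v < cnt p' v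
  · obtain ⟨v, hv⟩ := h2
    exact Or.inr (D.symm.le_of_cnt_lt hm hv)
  push Not at h1 h2
  have hp : Le p w := ⟨m * s, by rw [D.eq, mul_assoc], D.red_mul.assoc D.red⟩
  have hp' : Le p' w := ⟨m * s', by rw [D.eq', mul_assoc], D.red_mul'.assoc D.red'⟩
  have h3 := hp.eq_of_cnt_eq hp' fun v => le_antisymm (h1 v) (h2 v)
  exact (hne (by rw [D.left_eq, h3, mul_inv_cancel])).elim

end ShiftDecomp

/-- If `m` overlaps its translate by `e`, then `m` is, up to a star-word, a prefix of a power of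
`e`. -/
theorem exists_pow_mul {e m s s' : RAAG Γ} (hne : e ≠ 1) (heq : e * (m * s) = m * s')
    (he : Red e (m * s)) (hms : Red m s) (hms' : Red m s') :
    ∃ (j : ℕ) (d a b : RAAG Γ), m = e ^ j * d * b ∧ e = d * a ∧ Red d a ∧ starLength b ≤ 1 := by
  induction hn : len m using Nat.strong_induction_on generalizing m with
  | _ n ih =>
    obtain ⟨d, a, b, hea, hm, h1, h2, h3⟩ :=
      Le.exists_meet (x := e) (y := m) ⟨m * s, heq.symm, he⟩ ⟨s', rfl, hms'⟩
    -- If `b` is not a star-word, the commuting remainder `a` is trivial, so `e` is a prefix of `m`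
    -- and can be stripped off.
    by_cases hb : starLength b ≤ 1
    · exact ⟨0, d, a, b, by simpa using hm, hea, h1, hb⟩
    · obtain rfl := h3.eq_one (by omega)
      rw [mul_one] at hea
      subst hea hm
      have h4 := h2.len
      have h5 := len_pos hne
      rw [mul_assoc, mul_assoc] at heq
      obtain ⟨j, d, a, b', hb', he', h6, h7⟩ := ih (len b) (by omega) (mul_left_cancel heq)
        (hms.assoc h2) (hms.right h2) (hms'.right h2) rfl
      exact ⟨j + 1, d, a, b', by nth_rw 1 [hb']; rw [pow_succ']; simp only [mul_assoc], he', h6, h7⟩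

/-- With `p = p' * e` one has `h' = p' * e * p'⁻¹` and `e * m * s = m * s'`, so `m` is almost
periodic with period `e`. As `e` is a prefix of `m` and `e * m` is reduced, `e` is cyclically
reduced. -/
theorem ShiftDecomp.exists_root {w h h' p p' m s s' : RAAG Γ} {ρ : ℕ}
    (D : ShiftDecomp w h h' p p' m s s') (hh : starLength h ≤ ρ) (hh' : starLength h' ≤ ρ)
    (hρ : 3 * ρ + 5 ≤ starLength w) (hle : Le p' p)
    (hlt : ∀ u, cnt m u ≠ 0 → cnt p' u < cnt p u) :
    (∃ c e, h' = c * e * c⁻¹ ∧ Red e e ∧ Rich e) ∧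
      ∃ t : ℤ, starLength (h' ^ t * w) ≤ 2 * ρ + 1 := by
  have hml := D.starLength_le
  have hpl := D.starLength_p_le
  have hsl := D.starLength_s_le
  have hm : Rich m := rich_of_three_le (by omega)
  obtain ⟨e, rfl, hpe⟩ := hle
  have hrich : Rich e := hm.of_support fun u hu => by
    have := hlt u hu
    rw [hpe] at this
    omega
  have heq : e * (m * s) = m * s' := by
    have := D.eq.symm.trans D.eq'
    simp only [mul_assoc] at this
    exact mul_left_cancel this
  have hems : Red e (m * s) := ((D.red_mul.assoc D.red).right hpe)
  have hms : Red m s := D.red_mul.right D.red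
  have hms' : Red m s' := D.red_mul'.right D.red'
  have hel : starLength e ≤ ρ := hpe.starLength_le_right.trans (hpl.trans hh')
  have hne : e ≠ 1 := by
    rintro rfl
    obtain ⟨u, hu⟩ : ∃ u, cnt m u ≠ 0 := by
      by_contra! h
      rw [eq_one_of_cnt h, starLength_one] at hml
      omega
    have := hlt u hu
    simp at this
  have hle : Le e m := Le.of_starLength (w := m * s') ⟨m * s, heq.symm, hems⟩ ⟨s', rfl, hms'⟩
    (by omega)
  have hee : Red e e := by
    obtain ⟨b, rfl, hb⟩ := hle
    exact (hems.left hms).left hb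
  refine ⟨⟨p', e, D.left_eq, hee, hrich⟩, ?_⟩
  obtain ⟨j, d, a, b, hm', rfl, hda, hb⟩ := exists_pow_mul hne heq hems hms hms'
  -- This removes the `j` periods in `m` and the one in `p`. What remains is `p' * d * b * s`, of
  -- star length at most ρ + 1 + ρ.
  refine ⟨-(j + 1 : ℕ), ?_⟩
  have h1 : h' ^ (-(j + 1 : ℕ) : ℤ) * w = p' * d * b * s := by
    rw [zpow_neg, zpow_natCast, inv_mul_eq_iff_eq_mul, D.left_eq, conj_pow, D.eq, hm', pow_succ']
    simp only [mul_assoc, inv_mul_cancel_left]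
  have h2 : starLength (p' * d) ≤ ρ := by
    have h3 : Red (p' * d) a := hpe.assoc_symm hda
    refine h3.starLength_le_left.trans ?_
    rw [mul_assoc]
    exact hpl.trans hh'
  rw [h1]
  have h3 := starLength_mul_le (p' * d * b) s
  have h4 := starLength_mul_le (p' * d) b
  omega

theorem exists_root {w h h' : RAAG Γ} {ρ : ℕ} (hw : h' * w = w * h)
    (hh : starLength h ≤ ρ) (hh' : starLength h' ≤ ρ) (hρ : 3 * ρ + 5 ≤ starLength w)
    (hne : h' ≠ 1) :
    (∃ c e, h' = c * e * c⁻¹ ∧ Red e e ∧ Rich e) ∧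
      ∃ t : ℤ, starLength (h' ^ t * w) ≤ 2 * ρ + 1 := by
  obtain ⟨p, p', m, s, s', D⟩ := exists_shiftDecomp hw hh hh' (by omega)
  have hm : Rich m := rich_of_three_le (by have := D.starLength_le; omega)
  rcases D.trichotomy hm hne with ⟨h1, h2⟩ | ⟨h1, h2⟩
  · exact D.exists_root hh hh' hρ h1 h2
  · obtain ⟨⟨c, e, h3, h4, h5⟩, t, ht⟩ := D.symm.exists_root (ρ := ρ)
      (by rwa [starLength_inv]) (by rwa [starLength_inv]) hρ h1 h2
    refine ⟨⟨c, e⁻¹, ?_, h4.inv, h5.of_support fun v hv => by rwa [cnt_inv]⟩, -t, ?_⟩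
    · rw [← inv_inv h', h3]; group
    · rwa [inv_zpow'] at ht

end Shift

end RAAG

/-! ### Cyclic centralizers via translation vectors along a ray. -/

namespace RAAG

section Centralizer

variable {V : Type*} {Γ : SimpleGraph V}

/-- `x` is a prefix of the ray `e * e * ⋯`. -/
def RayPrefix (e x : RAAG Γ) : Prop := ∃ N, Le x (e ^ N)

/-- `z⁻¹` translates the far part of the ray `e * e * ⋯` by the vector `-n`. -/
def ShiftsBy (e z : RAAG Γ) (n : V → ℤ) : Prop :=
  ∃ K, ∀ x, RayPrefix e x → K ≤ starLength x →
    RayPrefix e (z⁻¹ * x) ∧ ∀ v, (cnt (z⁻¹ * x) v : ℤ) = cnt x v - n v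

theorem shiftsBy_one (e : RAAG Γ) : ShiftsBy e 1 0 :=
  ⟨0, fun x hx _ => by simpa using hx⟩

theorem ShiftsBy.mul {e z₁ z₂ : RAAG Γ} {n₁ n₂ : V → ℤ} (h₁ : ShiftsBy e z₁ n₁)
    (h₂ : ShiftsBy e z₂ n₂) : ShiftsBy e (z₁ * z₂) (n₁ + n₂) := by
  obtain ⟨K₁, h₁⟩ := h₁
  obtain ⟨K₂, h₂⟩ := h₂
  refine ⟨K₁ + K₂ + starLength z₁, fun x hx hK => ?_⟩
  obtain ⟨h3, h4⟩ := h₁ x hx (by omega)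
  have h5 := starLength_mul_le z₁ (z₁⁻¹ * x)
  rw [mul_inv_cancel_left] at h5
  obtain ⟨h6, h7⟩ := h₂ _ h3 (by omega)
  rw [mul_inv_rev, mul_assoc]
  refine ⟨h6, fun v => ?_⟩
  rw [h7, h4, Pi.add_apply]
  ring

variable [Fintype V]

theorem le_pow {e : RAAG Γ} (he : Red e e) {m n : ℕ} (h : m ≤ n) : Le (e ^ m) (e ^ n) :=
  ⟨e ^ (n - m), by rw [← pow_add]; congr 1; omega, red_pow_pow he _ _⟩

theorem le_pow_of_le {e x : RAAG Γ} (he : Red e e) {m n : ℕ} (hx : Le x (e ^ m)) (h : m ≤ n) :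
    Le x (e ^ n) :=
  hx.trans (le_pow he h)

variable [Nonempty V]

theorem exists_le_starLength_pow {e : RAAG Γ} (he : Red e e) (hr : Rich e) (M : ℕ) :
    ∃ n₀, ∀ n, n₀ ≤ n → M ≤ starLength (e ^ n) := by
  refine ⟨M * (max 4 (Fintype.card V) - 2) + 1, fun n hn => ?_⟩
  have h1 := lt_starLength_pow he hr (k := n) (by omega)
  have h2 : M * (max 4 (Fintype.card V) - 2) <
      (starLength (e ^ n) - 1) * (max 4 (Fintype.card V) - 2) := by omega
  have := Nat.lt_of_mul_lt_mul_right h2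
  omega

/-- Since `z` commutes with every `e ^ N`, `ShiftDecomp.le_inv_mul` applies to it. The vector is
read off at the fixed prefix `e ^ M`, so it does not depend on `N`. -/
theorem exists_shiftsBy {e z : RAAG Γ} (he : Red e e) (hr : Rich e) (hz : z * e = e * z) :
    ∃ n, ShiftsBy e z n := by
  obtain ⟨M, hM⟩ := exists_le_starLength_pow he hr (starLength z + 2)
  refine ⟨fun v => cnt (e ^ M) v - cnt (z⁻¹ * e ^ M) v, starLength z + 2, fun x ⟨N₁, hx⟩ hK => ?_⟩
  obtain ⟨L, hL⟩ := exists_le_starLength_pow he hr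
    (2 * starLength z + 2 + starLength x + starLength (e ^ M))
  obtain ⟨N, hN₁, hN₂, hN₃⟩ : ∃ N, N₁ ≤ N ∧ M ≤ N ∧ L ≤ N :=
    ⟨N₁ + M + L, by omega, by omega, by omega⟩
  have hw := hL N hN₃
  obtain ⟨p, p', m, s, s', D⟩ := exists_shiftDecomp (w := e ^ N) (h := z) (h' := z)
    ((show Commute z e from hz).pow_right N) le_rfl le_rfl (by omega)
  have main : ∀ x, Le x (e ^ N) → starLength z + 2 ≤ starLength x →
      starLength x + starLength z + 2 ≤ starLength (e ^ N) →
      Le (z⁻¹ * x) (e ^ N) ∧ ∀ v, cnt (z⁻¹ * x) v + cnt p v = cnt x v + cnt p' v := by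
    rintro x ⟨y, hxy, hr⟩ h1 h2
    have h3 := starLength_mul_le x y
    rw [← hxy] at h3
    exact D.le_inv_mul hxy hr h1 (by omega)
  obtain ⟨h1, h2⟩ := main x (le_pow_of_le he hx hN₁) hK (by omega)
  obtain ⟨-, h3⟩ := main (e ^ M) (le_pow he hN₂) (hM M le_rfl) (by omega)
  refine ⟨⟨N, h1⟩, fun v => ?_⟩
  dsimp only
  have := h2 v
  have := h3 v
  omega

theorem ShiftsBy.unique {e z : RAAG Γ} {n n' : V → ℤ} (he : Red e e) (hr : Rich e)
    (h : ShiftsBy e z n) (h' : ShiftsBy e z n') : n = n' := by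
  obtain ⟨K, h⟩ := h
  obtain ⟨K', h'⟩ := h'
  obtain ⟨M, hM⟩ := exists_le_starLength_pow he hr (K + K')
  have hM := hM M le_rfl
  funext v
  have h1 := (h (e ^ M) ⟨M, le_pow he le_rfl⟩ (by omega)).2 v
  have h2 := (h' (e ^ M) ⟨M, le_pow he le_rfl⟩ (by omega)).2 v
  omega

/-- A shift that vanishes at a vertex of the support vanishes at all non-adjacent vertices. -/
theorem ShiftsBy.eq_zero_of_eq_zero {e z : RAAG Γ} {n : V → ℤ} (he : Red e e) (hr : Rich e)
    (h : ShiftsBy e z n) {u v : V} (hu : cnt e u ≠ 0) (huv : ¬Γ.Adj u v) (hn : n u = 0) :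
    n v = 0 := by
  by_cases hne : v = u
  · rwa [hne]
  obtain ⟨K, h⟩ := h
  obtain ⟨M, hM⟩ := exists_le_starLength_pow he hr K
  obtain ⟨x₀, a, y, hxy, rfl, h1, h2⟩ := exists_letter hu
  set x := e ^ M * x₀ with hx
  have h3 : Red (e ^ M) (x₀ * letter a * y) := by
    rw [← hxy]
    simpa using red_pow_pow he M 1
  have h4 : Red (e ^ M) (x₀ * letter a) := h3.left h2
  have h5 : Red (e ^ M) x₀ := h4.left h1
  have hxa : Red x (letter a) := h4.assoc_symm h1
  have le1 : Le (x * letter a) (e ^ (M + 1)) :=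
    ⟨y, by rw [pow_succ, hx]; nth_rw 2 [hxy]; simp only [mul_assoc], by
      rw [hx, mul_assoc (e ^ M)]
      exact h3.assoc_symm h2⟩
  have le2 : Le x (e ^ (M + 1)) := (show Le x (x * letter a) from ⟨_, rfl, hxa⟩).trans le1
  have hK : K ≤ starLength x := (hM M le_rfl).trans h5.starLength_le_left
  have hK' : K ≤ starLength (x * letter a) := hK.trans hxa.starLength_le_left
  obtain ⟨⟨N₁, h6⟩, h7⟩ := h x ⟨_, le2⟩ hK
  obtain ⟨⟨N₂, h8⟩, h9⟩ := h (x * letter a) ⟨_, le1⟩ hK'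
  obtain ⟨N, hN, hN₁, hN₂⟩ : ∃ N, M + 1 ≤ N ∧ N₁ ≤ N ∧ N₂ ≤ N :=
    ⟨M + 1 + N₁ + N₂, by omega, by omega, by omega⟩
  have ha : cnt (x * letter a) a.1 = cnt x a.1 + 1 := by rw [hxa, cnt_letter_self]
  have hv : cnt (x * letter a) v = cnt x v := by rw [hxa, cnt_letter_of_ne hne, add_zero]
  have c1 := h7 a.1
  have c2 := h7 v
  have c3 := h9 a.1
  have c4 := h9 v
  -- The shift fixes the `u`-counts, so `x` and `x * a` interleave with their translates there.
  -- Since `u` and `v` are ordered, the `v`-counts are squeezed from both sides.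
  have c5 := (le_pow_of_le he le2 hN).cnt_le_cnt (le_pow_of_le he h8 hN₂) huv (by omega)
  have c6 := (le_pow_of_le he h6 hN₁).cnt_le_cnt (le_pow_of_le he le1 hN) huv (by omega)
  omega

/-- Vanishing spreads over the rich support and then to all vertices. A long `e ^ M` and its
translate are then prefixes with equal counts. -/
theorem ShiftsBy.eq_one {e z : RAAG Γ} {n : V → ℤ} (he : Red e e) (hr : Rich e)
    (h : ShiftsBy e z n) {u : V} (hu : cnt e u ≠ 0) (hn : n u = 0) : z = 1 := by
  have h1 : ∀ v, cnt e v ≠ 0 → n v = 0 := by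
    by_contra! hex
    obtain ⟨v, hv, hv'⟩ := hex
    obtain ⟨a, ha, b, hb, ha', -, hab⟩ := hr.2 {v | n v = 0} ⟨u, hn, hu⟩ ⟨v, hv', hv⟩
    exact hb (h.eq_zero_of_eq_zero he hr ha' hab ha)
  have h2 : ∀ v, n v = 0 := fun v => by
    obtain ⟨w, hw, -, hvw⟩ := hr.1 v
    exact h.eq_zero_of_eq_zero he hr hw (fun h => hvw h.symm) (h1 w hw)
  obtain ⟨K, h⟩ := h
  obtain ⟨M, hM⟩ := exists_le_starLength_pow he hr K
  obtain ⟨⟨N, h3⟩, h4⟩ := h (e ^ M) ⟨M, le_pow he le_rfl⟩ (hM M le_rfl)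
  have h5 := (le_pow_of_le he h3 (le_max_left N M)).eq_of_cnt_eq (le_pow he (le_max_right N M))
    fun v => by
      have := h4 v
      have := h2 v
      omega
  simpa using h5

/-- Centralizers of cyclically reduced elements with rich support are cyclic. -/
theorem isCyclic_centralizer {e : RAAG Γ} (he : Red e e) (hr : Rich e) :
    IsCyclic (Subgroup.centralizer {e}) := by
  obtain ⟨u, hu⟩ := hr.exists_cnt_ne_zero
  have hex : ∀ z : Subgroup.centralizer {e}, ∃ n, ShiftsBy e z n := fun z =>
    exists_shiftsBy he hr (Subgroup.mem_centralizer_singleton_iff.1 z.2)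
  choose n hn using hex
  -- One coordinate of the translation vector, at a vertex of the support, already embeds the
  -- centralizer in ℤ.
  let φ : Subgroup.centralizer {e} →* Multiplicative ℤ :=
    { toFun := fun z => Multiplicative.ofAdd (n z u)
      map_one' := by
        rw [(hn 1).unique he hr (shiftsBy_one e)]
        rfl
      map_mul' := fun z₁ z₂ => by
        rw [(hn (z₁ * z₂)).unique he hr ((hn z₁).mul (hn z₂))]
        rfl }
  refine isCyclic_of_injective φ ((injective_iff_map_eq_one φ).2 fun z hz => Subtype.ext ?_)
  exact (hn z).eq_one he hr hu (by simpa [φ] using hz)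

end Centralizer

end RAAG

/-! ### Structure of quasi-stabilizers. -/

namespace RAAG

section QuasiStabilizer

variable {V : Type*} {Γ : SimpleGraph V}

theorem starLength_zpow (g : RAAG Γ) (m : ℤ) : starLength (g ^ m) = starLength (g ^ m.natAbs) := by
  rcases Int.natAbs_eq m with h | h
  · conv_lhs => rw [h, zpow_natCast]
  · conv_lhs => rw [h, zpow_neg, zpow_natCast, starLength_inv]

theorem starLength_le_conj (c g : RAAG Γ) :
    starLength g ≤ starLength (c * g * c⁻¹) + 2 * starLength c := by
  have h1 := starLength_mul_le (c⁻¹ * (c * g * c⁻¹)) c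
  have h2 := starLength_mul_le c⁻¹ (c * g * c⁻¹)
  rw [starLength_inv] at h2
  rw [show c⁻¹ * (c * g * c⁻¹) * c = g by group] at h1
  omega

theorem starLength_conj_le (c g : RAAG Γ) :
    starLength (c * g * c⁻¹) ≤ starLength g + 2 * starLength c := by
  have h1 := starLength_le_conj c⁻¹ (c * g * c⁻¹)
  rw [show c⁻¹ * (c * g * c⁻¹) * c⁻¹⁻¹ = g by group, starLength_inv] at h1
  exact h1

theorem mem_quasiStabilizer {x y γ : RAAG Γ} {r : ℝ} (hr : 0 ≤ r) :
    γ ∈ quasiStabilizer (RAAG Γ) x y r ↔ starLength (x * γ * x⁻¹) ≤ ⌊r⌋₊ ∧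
      starLength ((x * y⁻¹)⁻¹ * (x * γ * x⁻¹) * (x * y⁻¹)) ≤ ⌊r⌋₊ := by
  rw [show (x * y⁻¹)⁻¹ * (x * γ * x⁻¹) * (x * y⁻¹) = y * γ * y⁻¹ by group, Nat.le_floor_iff hr,
    Nat.le_floor_iff hr]
  rfl

variable [Fintype V]

theorem CycRed.starLength_pow_le {c e : RAAG Γ} (h : CycRed c e) (n : ℕ) :
    starLength (e ^ n) ≤ starLength ((c * e * c⁻¹) ^ n) := by
  rcases eq_or_ne n 0 with rfl | hn
  · simp
  · obtain ⟨h1, h2⟩ := h.pow n hn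
    rw [conj_pow]
    exact h1.starLength_le_right.trans h2.starLength_le_left

/-- After cyclic reduction, the smaller power arises from the larger by deleting a middle factor of
a reduced product. -/
theorem starLength_pow_mono (g : RAAG Γ) {m n : ℕ} (hmn : m ≤ n) :
    starLength (g ^ m) ≤ starLength (g ^ n) := by
  rcases eq_or_ne m 0 with rfl | hm
  · simp [starLength_one]
  obtain ⟨c, e, rfl, h⟩ := exists_cycRed g
  obtain ⟨k, rfl⟩ := Nat.exists_eq_add_of_le hmn
  obtain ⟨h1, h2⟩ := h.pow m hm
  obtain ⟨h3, h4⟩ := h.pow (m + k) (by omega)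
  rw [conj_pow, conj_pow, pow_add]
  have h5 := red_pow_pow h.red_self m k
  rw [pow_add] at h3 h4
  rw [← mul_assoc] at h4 ⊢
  exact starLength_delete_le (h3.assoc_symm h5) h4 h2

variable [Nonempty V]

/-- The conjugates of a cyclically reduced element with rich support are loxodromic. -/
theorem isLoxodromic_conj {c e : RAAG Γ} (he : Red e e) (hr : Rich e) :
    IsLoxodromic (RAAG Γ) (c * e * c⁻¹) := by
  have hsub : Subadditive fun n : ℕ => (starLength (e ^ n) : ℝ) := fun m n => by
    simp only [pow_add]
    exact_mod_cast starLength_mul_le _ _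
  have hlim := hsub.tendsto_lim ⟨0, by rintro _ ⟨n, rfl⟩; positivity⟩
  set K : ℕ := max 4 (Fintype.card V) - 2 with hK
  have hK0 : (0 : ℝ) < K := by
    have : 0 < K := by omega
    exact_mod_cast this
  refine ⟨hsub.lim, ?_, fun x => ?_⟩
  · have h1 : (1 : ℝ) / K ≤ hsub.lim := by
      refine ge_of_tendsto hlim ?_
      filter_upwards [Filter.eventually_gt_atTop 0] with n hn
      have h2 := lt_starLength_pow he hr (k := n) hn.ne'
      have h3 : n ≤ starLength (e ^ n) * K :=
        h2.le.trans (Nat.mul_le_mul_right _ (Nat.sub_le _ _))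
      have hn' : (0 : ℝ) < n := by exact_mod_cast hn
      rw [div_le_div_iff₀ hK0 hn', one_mul]
      exact_mod_cast h3
    exact lt_of_lt_of_le (by positivity) h1
  · have hdist : ∀ n : ℕ, dist (x <• ((c * e * c⁻¹) ^ n)) x =
        starLength ((x * c) * e ^ n * (x * c)⁻¹) := fun n => by
      rw [smul_def, dist_def, conj_pow]
      congr 2
      group
    have hC : Filter.Tendsto (fun n : ℕ => (2 * starLength (x * c) : ℝ) / n) Filter.atTop (nhds 0) :=
      tendsto_const_div_atTop_nhds_zero_nat _
    have hlo := hlim.sub hC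
    have hhi := hlim.add hC
    rw [sub_zero] at hlo
    rw [add_zero] at hhi
    refine tendsto_of_tendsto_of_tendsto_of_le_of_le hlo hhi (fun n => ?_) fun n => ?_
    · dsimp only
      rw [hdist, ← sub_div]
      refine div_le_div_of_nonneg_right ?_ (Nat.cast_nonneg n)
      have := starLength_le_conj (x * c) (e ^ n)
      rw [sub_le_iff_le_add]
      exact_mod_cast this
    · dsimp only
      rw [hdist, ← add_div]
      refine div_le_div_of_nonneg_right ?_ (Nat.cast_nonneg n)
      exact_mod_cast starLength_conj_le (x * c) (e ^ n)

/-- All admissible `z` commute with `z₀`, whose centralizer is cyclic. Its generator is `c * e *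
c⁻¹`. -/
theorem exists_generator {w z₀ : RAAG Γ} {ρ : ℕ} (hρ : 4 * ρ + 5 ≤ starLength w) (hz₀ : z₀ ≠ 1)
    (h₁ : starLength z₀ ≤ ρ) (h₂ : starLength (w⁻¹ * z₀ * w) ≤ ρ) :
    ∃ c e : RAAG Γ, Red e e ∧ Rich e ∧
      (∃ k, 1 ≤ k ∧ k < (ρ - 1) * (max 4 (Fintype.card V) - 2) ∧
        ∀ z, starLength z ≤ ρ ∧ starLength (w⁻¹ * z * w) ≤ ρ ↔
          ∃ m : ℤ, |m| ≤ (k : ℤ) ∧ z = (c * e * c⁻¹) ^ m) ∧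
      ∃ t : ℤ, starLength ((c * e * c⁻¹) ^ t * w) ≤ 2 * ρ + 1 := by
  have hw : ∀ z : RAAG Γ, z * w = w * (w⁻¹ * z * w) := fun z => by group
  obtain ⟨⟨c₀, e₀, hz, he₀, hr₀⟩, t, ht⟩ := exists_root (hw z₀) h₂ h₁ (by omega) hz₀
  obtain ⟨⟨g₀, hg₀⟩, hgen⟩ := isCyclic_centralizer he₀ hr₀
  obtain ⟨c, e, hg, hce⟩ := exists_cycRed (c₀ * g₀ * c₀⁻¹)
  have hpow : ∀ z, starLength z ≤ ρ → starLength (w⁻¹ * z * w) ≤ ρ →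
      ∃ m : ℤ, z = (c * e * c⁻¹) ^ m := by
    intro z hz1 hz2
    have h3 := commute_of_le_starLength (hw z) (hw z₀) hz2 hz1 h₂ h₁ (by omega)
    have h4 : c₀⁻¹ * z * c₀ ∈ Subgroup.centralizer {e₀} := by
      rw [Subgroup.mem_centralizer_singleton_iff]
      rw [hz] at h3
      calc c₀⁻¹ * z * c₀ * e₀ = c₀⁻¹ * (z * (c₀ * e₀ * c₀⁻¹)) * c₀ := by group
        _ = e₀ * (c₀⁻¹ * z * c₀) := by rw [h3]; group
    obtain ⟨m, hm⟩ := hgen ⟨_, h4⟩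
    refine ⟨m, ?_⟩
    have h5 : g₀ ^ m = c₀⁻¹ * z * c₀ := congrArg Subtype.val hm
    rw [← hg, conj_zpow, h5]
    group
  obtain ⟨a, ha⟩ := hpow z₀ h₁ h₂
  have ha0 : a ≠ 0 := by
    rintro rfl
    exact hz₀ (by rw [ha, zpow_zero])
  -- A high power of `z₀` is conjugate to a power of `e` and has large star length. Powers of `e`
  -- have no letters outside its support.
  have hrich : Rich e := by
    obtain ⟨M, hM⟩ := exists_le_starLength_pow he₀ hr₀ (2 * starLength c₀ + 2 * starLength c + 3)
    have h3 := hM M le_rfl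
    have h4 := starLength_le_conj c₀ (e₀ ^ M)
    have h5 : c₀ * e₀ ^ M * c₀⁻¹ = c * e ^ (a * M) * c⁻¹ := by
      rw [← conj_pow, ← hz, ha, ← zpow_natCast, ← zpow_mul, conj_zpow]
    have h6 := starLength_conj_le c (e ^ (a * M))
    rw [h5] at h4
    have h7 : 3 ≤ starLength (e ^ (a * M)) := by omega
    rw [starLength_zpow] at h7
    refine (rich_of_three_le h7).of_support fun v hv => ?_
    rw [cnt_pow hce.red_self] at hv
    exact right_ne_zero_of_mul hv
  set g := c * e * c⁻¹ with hgdef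
  have hconj : ∀ m : ℤ, w⁻¹ * g ^ m * w = (w⁻¹ * g * w) ^ m := fun m => by
    have h := conj_zpow (i := m) (a := w⁻¹) (b := g)
    rw [inv_inv] at h
    exact h.symm
  have hbound : ∀ m : ℕ, starLength (g ^ m) ≤ ρ → m ≠ 0 →
      m < (ρ - 1) * (max 4 (Fintype.card V) - 2) := fun m hm hm0 =>
    (lt_starLength_pow hce.red_self hrich hm0).trans_le
      (Nat.mul_le_mul_right _ (Nat.sub_le_sub_right ((hce.starLength_pow_le m).trans hm) 1))
  classical
  set P : ℕ → Prop := fun m => starLength (g ^ m) ≤ ρ ∧ starLength ((w⁻¹ * g * w) ^ m) ≤ ρ with hP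
  have hPa : P a.natAbs := by
    rw [ha] at h₁ h₂
    rw [hconj] at h₂
    rw [starLength_zpow] at h₁ h₂
    exact ⟨h₁, h₂⟩
  have hPle : ∀ m, P m → m ≤ (ρ - 1) * (max 4 (Fintype.card V) - 2) := fun m hm => by
    rcases eq_or_ne m 0 with rfl | hm0
    · omega
    · exact (hbound m hm.1 hm0).le
  -- The largest admissible exponent; by monotonicity all smaller ones are admissible too.
  set k := Nat.findGreatest P ((ρ - 1) * (max 4 (Fintype.card V) - 2)) with hk
  have hPk : P k := Nat.findGreatest_spec (hPle _ hPa) hPa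
  have hkle : ∀ m, P m → m ≤ k := fun m hm => Nat.le_findGreatest (hPle _ hm) hm
  have hk1 : 1 ≤ k := (Int.natAbs_pos.2 ha0).trans_le (hkle _ hPa)
  refine ⟨c, e, hce.red_self, hrich, ⟨k, hk1, hbound k hPk.1 (by omega), fun z => ⟨?_, ?_⟩⟩, ?_⟩
  · rintro ⟨hz1, hz2⟩
    obtain ⟨m, rfl⟩ := hpow z hz1 hz2
    rw [hconj, starLength_zpow] at hz2
    rw [starLength_zpow] at hz1
    refine ⟨m, ?_, rfl⟩
    have := hkle m.natAbs ⟨hz1, hz2⟩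
    rw [Int.abs_eq_natAbs]
    omega
  · rintro ⟨m, hm, rfl⟩
    have hm' : m.natAbs ≤ k := by rw [Int.abs_eq_natAbs] at hm; omega
    rw [hconj, starLength_zpow, starLength_zpow (w⁻¹ * g * w)]
    exact ⟨(starLength_pow_mono g hm').trans hPk.1, (starLength_pow_mono _ hm').trans hPk.2⟩
  · refine ⟨a * t, ?_⟩
    rwa [zpow_mul, ← ha]

/-- The structure of non-trivial quasi-stabilizers of distant points. -/
theorem quasiStabilizer_eq {x y : RAAG Γ} {r : ℝ} (hr : 0 < r) (hxy : 15 * r + 8 ≤ dist x y)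
    (hne : quasiStabilizer (RAAG Γ) x y r ≠ {1}) :
    ∃ g : RAAG Γ, IsLoxodromic (RAAG Γ) g ∧
      (∃ k : ℕ, 1 ≤ k ∧ (k : ℝ) ≤ (max 4 (Fintype.card V : ℝ) - 2) * (r - 1) - 1 ∧
        quasiStabilizer (RAAG Γ) x y r = {h | ∃ m : ℤ, |m| ≤ (k : ℤ) ∧ h = g ^ m}) ∧
      Metric.hausdorffEDist (cyclicOrbit g x) (cyclicOrbit g y) ≤ ENNReal.ofReal (2 * r + 3) := by
  have hfl := Nat.floor_le hr.le
  set ρ := ⌊r⌋₊ with hρ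
  have hw : 4 * ρ + 5 ≤ starLength (x * y⁻¹) := by
    rw [dist_def] at hxy
    have : (4 * ρ + 5 : ℝ) ≤ starLength (x * y⁻¹) := by linarith
    exact_mod_cast this
  obtain ⟨γ, hγ, hγ1⟩ : ∃ γ ∈ quasiStabilizer (RAAG Γ) x y r, γ ≠ 1 := by
    by_contra! h
    refine hne (Set.eq_singleton_iff_unique_mem.2 ⟨?_, h⟩)
    rw [mem_quasiStabilizer hr.le]
    simp [starLength_one]
  rw [mem_quasiStabilizer hr.le] at hγ
  obtain ⟨c, e, he, hrich, ⟨k, hk1, hk, hset⟩, t, ht⟩ :=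
    exists_generator hw (z₀ := x * γ * x⁻¹) (by simpa using hγ1) hγ.1 hγ.2
  set g := c * e * c⁻¹ with hg
  have hgx : ∀ m : ℤ, (x⁻¹ * g * x) ^ m = x⁻¹ * g ^ m * x := fun m => by
    have h := conj_zpow (i := m) (a := x⁻¹) (b := g)
    rwa [inv_inv] at h
  refine ⟨x⁻¹ * g * x, ?_, ⟨k, hk1, ?_, ?_⟩, ?_⟩
  · have := isLoxodromic_conj (c := x⁻¹ * c) he hrich
    rwa [show x⁻¹ * c * e * (x⁻¹ * c)⁻¹ = x⁻¹ * g * x by rw [hg]; group] at this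
  -- For ρ = 0 the truncated bound in `hk` is 0, which no `k` satisfies.
  · have hρ1 : 1 ≤ ρ := by
      by_contra h
      have : ρ = 0 := by omega
      rw [this] at hk
      simp at hk
    have h1 : k + 1 ≤ (ρ - 1) * (max 4 (Fintype.card V) - 2) := hk
    have h2 : ((k : ℝ) + 1) ≤ (ρ - 1) * (max 4 (Fintype.card V : ℝ) - 2) := by
      have h3 : ((k + 1 : ℕ) : ℝ) ≤ ((ρ - 1) * (max 4 (Fintype.card V) - 2) : ℕ) := by
        exact_mod_cast h1
      rw [Nat.cast_mul, Nat.cast_sub hρ1, Nat.cast_sub (by omega)] at h3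
      push_cast at h3
      exact h3
    have h4 : (4 : ℝ) ≤ max 4 (Fintype.card V : ℝ) := le_max_left _ _
    have h5 : ((ρ : ℝ) - 1) * (max 4 (Fintype.card V : ℝ) - 2) ≤
        (r - 1) * (max 4 (Fintype.card V : ℝ) - 2) :=
      mul_le_mul_of_nonneg_right (by linarith) (by linarith)
    linarith
  · ext h
    rw [mem_quasiStabilizer hr.le, hset, Set.mem_ofPred_eq]
    refine exists_congr fun m => and_congr_right fun _ => ?_
    rw [hgx]
    constructor
    · intro h1
      rw [← h1]
      group
    · rintro rfl
      group
  -- The orbits are matched with the exponent offset `t`, the power that shortens `x * y⁻¹`.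
  · have hdist : ∀ m n : ℤ, m - n = t →
        edist (x <• (x⁻¹ * g * x) ^ m) (y <• (x⁻¹ * g * x) ^ n) ≤ ENNReal.ofReal (2 * r + 3) := by
      intro m n hmn
      rw [edist_dist]
      refine ENNReal.ofReal_le_ofReal ?_
      rw [smul_def, smul_def, dist_def, mul_inv_rev, ← mul_assoc, mul_assoc x, ← zpow_neg,
        ← zpow_add, ← sub_eq_add_neg, hmn, hgx]
      rw [show x * (x⁻¹ * g ^ t * x) * y⁻¹ = g ^ t * (x * y⁻¹) by group]
      have : (starLength (g ^ t * (x * y⁻¹)) : ℝ) ≤ 2 * ρ + 1 := by exact_mod_cast ht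
      linarith
    refine Metric.hausdorffEDist_le_of_mem_edist ?_ ?_
    · rintro _ ⟨m, rfl⟩
      exact ⟨_, ⟨m - t, rfl⟩, hdist _ _ (by ring)⟩
    · rintro _ ⟨n, rfl⟩
      refine ⟨_, ⟨n + t, rfl⟩, ?_⟩
      rw [edist_comm]
      exact hdist _ _ (by ring)

end QuasiStabilizer

end RAAG

/-! ### The main theorem. -/

theorem mainTheorem3 {V : Type*} [Fintype V] (Γ : SimpleGraph V)
    (hcard : 2 ≤ Fintype.card V) (hconn : Γᶜ.Connected)
    (v : ℝ) (hv : v = max 4 (Fintype.card V : ℝ))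
    (R : ℝ → ℝ) (hR : ∀ r, R r = (2 * v + 7) * r + 8)
    (N : ℝ → ℝ) (hN : ∀ r, N r = max 1 (2 * (v - 2) * (r - 1) - 1)) :
    IsAcylindricalWith (RAAG Γ) (RAAG Γ) R N ∧
    ∀ r : ℝ, 0 < r → ∀ x y : RAAG Γ, R r ≤ dist x y →
      quasiStabilizer (RAAG Γ) x y r ≠ {1} →
      ∃ g : RAAG Γ, IsLoxodromic (RAAG Γ) g ∧
        (∃ k : ℕ, 1 ≤ k ∧ (k : ℝ) ≤ (v - 2) * (r - 1) - 1 ∧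
          quasiStabilizer (RAAG Γ) x y r = {h | ∃ m : ℤ, |m| ≤ (k : ℤ) ∧ h = g ^ m}) ∧
        Metric.hausdorffEDist (cyclicOrbit g x) (cyclicOrbit g y) ≤
          ENNReal.ofReal (2 * r + 3) := by
  have : Nonempty V := hconn.nonempty
  have hv4 : 4 ≤ v := hv ▸ le_max_left _ _
  have main : ∀ r : ℝ, 0 < r → ∀ x y : RAAG Γ, R r ≤ dist x y →
      quasiStabilizer (RAAG Γ) x y r ≠ {1} →
      ∃ g : RAAG Γ, IsLoxodromic (RAAG Γ) g ∧
        (∃ k : ℕ, 1 ≤ k ∧ (k : ℝ) ≤ (v - 2) * (r - 1) - 1 ∧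
          quasiStabilizer (RAAG Γ) x y r = {h | ∃ m : ℤ, |m| ≤ (k : ℤ) ∧ h = g ^ m}) ∧
        Metric.hausdorffEDist (cyclicOrbit g x) (cyclicOrbit g y) ≤
          ENNReal.ofReal (2 * r + 3) := by
    intro r hr x y hxy hne
    rw [hv]
    -- As `v ≥ 4`, the coefficient `2 * v + 7` is at least 15.
    refine RAAG.quasiStabilizer_eq hr (le_trans ?_ hxy) hne
    rw [hR]
    nlinarith
  refine ⟨fun r hr => ⟨?_, ?_, fun x y hxy => ?_⟩, main⟩
  · rw [hR]
    positivity
  · rw [hN]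
    exact lt_max_of_lt_left one_pos
  · by_cases hne : quasiStabilizer (RAAG Γ) x y r = {1}
    · rw [hne, hN, Set.ncard_singleton, Nat.cast_one]
      exact ⟨Set.finite_singleton 1, le_max_left _ _⟩
    · obtain ⟨g, -, ⟨k, -, hk, hset⟩, -⟩ := main r hr x y hxy hne
      have himage : quasiStabilizer (RAAG Γ) x y r =
          (fun m : ℤ => g ^ m) '' (Finset.Icc (-k : ℤ) k : Set ℤ) := by
        rw [hset]
        ext h
        simp only [Set.mem_ofPred_eq, Set.mem_image, Finset.mem_coe, Finset.mem_Icc, abs_le]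
        exact exists_congr fun m => and_congr_right fun _ => eq_comm
      -- There are 2k + 1 exponents, and k ≤ (v - 2)(r - 1) - 1 turns this into 2(v - 2)(r - 1) - 1.
      have hncard : (quasiStabilizer (RAAG Γ) x y r).ncard ≤ 2 * k + 1 := by
        rw [himage]
        refine (Set.ncard_image_le (Finset.finite_toSet _)).trans ?_
        rw [Set.ncard_coe_finset, Int.card_Icc]
        omega
      refine ⟨himage ▸ (Finset.finite_toSet _).image _, ?_⟩
      rw [hN]
      refine le_max_of_le_right ?_
      have : ((quasiStabilizer (RAAG Γ) x y r).ncard : ℝ) ≤ 2 * k + 1 := by exact_mod_cast hncard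
      linarith
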